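/- Let $m,N\ge 1$ be integers, let $\mathbb{M}$ be the space of real $m\times N$ matrices with the Euclidean norm $|\cdot|$, let $Y:=\,]-\tfrac12,\tfrac12[^N$ and, for $\xi\in\mathbb{M}$, let $l_\xi(y):=\xi y$. Let $L:\mathbb{M}\to[0,\infty]$ be continuous and finite (that is, $L(\xi)<\infty$ for every $\xi\in\mathbb{M}$), and assume that: - (D$_1$) there exists $\lambda:\,]0,\infty[\,\to\,]0,1[$ such that $\lambda(R)\to1$ as $R\to\infty$ and $$\lim_{R\to\infty}\ \sup_{|\xi|\ge R}\frac{L(\lambda(R)\xi)}{L(\xi)}=0$$ (with the conventions $0/0=0$ and $a/0=\infty$ for $a>0$); - (D$_2$) there exists $\alpha_1>0$ such that $L(t\xi)\le\alpha_1(1+L(\xi))$ for all $\xi\in\mathbb{M}$ and all $t\in\,]0,1[$; - (D$_3$) there exist $\alpha_2>0$ and $\varepsilon>0$ such that for every $\xi\in\mathbb{M}$ and every $t\in[0,1[$ there exists $c_{\xi,t}>0$ for which $$L(\xi+s\zeta+e)\le\alpha_2(1+L(\xi+\zeta))$$ for all $s\in[0,t]$, all $\zeta\in\mathbb{M}$ with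 $|\zeta|\ge c_{\xi,t}$ and all $e\in\mathbb{M}$ with $|e|\le\varepsilon$. Then, for every $p\in\,]N,\infty[$, the following localization principle (C$_{p,p}$) holds: for every $\xi\in\mathbb{M}$ and every sequence $\{v_n\}_n\subset W^{1,p}(Y;\mathbb{R}^m)$ such that $$v_n\rightharpoonup l_\xi\ \text{ weakly in } W^{1,p}(Y;\mathbb{R}^m)\quad\text{and}\quad \sup_n\int_Y L(\nabla v_n(y))\,dy<\infty,$$ there exist a subsequence $\{v_{\sigma(n)}\}_n$ and a sequence $\{w_n\}_n\subset l_\xi+W^{1,p}_0(Y;\mathbb{R}^m)$ such that $$|\nabla v_{\sigma(n)}-\nabla w_n|\to0\ \text{ in measure on } Y\quad\text{and}\quad \{L(\nabla w_n)\}_n\ \text{ is equi-integrable on } Y,$$ where equi-integrable means that for every $\eta>0$ there is $\delta>0$ such that $\int_A L(\nabla w_n)\,dy\le\eta$ for all $n$ and all measurable $A\subset Y$ with $|A|\le\delta$, and $W^{1,p}_0(Y;\mathbb{R}^m)$ is the closure of $C^\infty_c(Y;\mathbb{R}^m)$ in $W^{1,p}(Y;\mathbb{R}^m)$. -/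

import Mathlib

open MeasureTheory Filter Topology Set
open scoped ENNReal NNReal

namespace LocPrinciple

/-- The space `𝕄` of all real `m × N` matrices `ξ = (ξ (i, j))`, with the Euclidean (Frobenius)
norm. -/
abbrev Mat (m N : ℕ) : Type := EuclideanSpace ℝ (Fin m × Fin N)

/-- The open unit cube `Y = ]-1/2, 1/2[^N` of `ℝ^N`. -/
def unitCube (N : ℕ) : Set (EuclideanSpace ℝ (Fin N)) :=
  {y | ∀ j, -(1 / 2 : ℝ) < y j ∧ y j < 1 / 2}

/-- Lebesgue measure on the cube `Y`. -/
noncomputable def cubeMeasure (N : ℕ) : Measure (EuclideanSpace ℝ (Fin N)) :=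
  volume.restrict (unitCube N)

/-- `φ ∈ C_c^∞(Y; F)`, extended by zero outside of `Y`. -/
def IsTestFunction (N : ℕ) {F : Type*} [NormedAddCommGroup F] [NormedSpace ℝ F]
    (φ : EuclideanSpace ℝ (Fin N) → F) : Prop :=
  ContDiff ℝ (⊤ : ℕ∞) φ ∧ HasCompactSupport φ ∧ tsupport φ ⊆ unitCube N

/-- `G` is the distributional gradient of `v` in `Y`:
`∫_Y v_i ∂_j φ = - ∫_Y G_ij φ` for all `i`, `j` and all `φ ∈ C_c^∞(Y)`.
(Used for `v` and `G` in `L^p(Y)` only, `p ≥ 1`, so that all these integrals converge.) -/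
def IsWeakGradient (m N : ℕ) (v : EuclideanSpace ℝ (Fin N) → EuclideanSpace ℝ (Fin m))
    (G : EuclideanSpace ℝ (Fin N) → Mat m N) : Prop :=
  ∀ φ : EuclideanSpace ℝ (Fin N) → ℝ, IsTestFunction N φ → ∀ (i : Fin m) (j : Fin N),
    ∫ y, v y i * fderiv ℝ φ y (EuclideanSpace.single j 1) ∂cubeMeasure N
      = -∫ y, G y (i, j) * φ y ∂cubeMeasure N

theorem unitCube_subset_Icc (N : ℕ) : unitCube N ⊆
    (EuclideanSpace.equiv (Fin N) ℝ) ⁻¹' Icc (fun _ => -(1 / 2 : ℝ)) (fun _ => 1 / 2) :=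
  fun _ hy => ⟨fun j => (hy j).1.le, fun j => (hy j).2.le⟩

theorem isOpen_unitCube (N : ℕ) : IsOpen (unitCube N) := by
  have : unitCube N = ⋂ j, {y | -(1 / 2 : ℝ) < y j ∧ y j < 1 / 2} := by
    ext y; simp [unitCube]
  rw [this]
  refine isOpen_iInter_of_finite fun j => ?_
  have hc : Continuous fun y : EuclideanSpace ℝ (Fin N) => y j := by fun_prop
  exact (isOpen_lt continuous_const hc).inter (isOpen_lt hc continuous_const)

theorem isCompact_bigCube (N : ℕ) : IsCompact
    ((EuclideanSpace.equiv (Fin N) ℝ) ⁻¹' Icc (fun _ => -(1 / 2 : ℝ)) (fun _ => 1 / 2)) :=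
  (EuclideanSpace.equiv (Fin N) ℝ).toHomeomorph.isCompact_preimage.2 isCompact_Icc

instance instFiniteCubeMeasure (N : ℕ) : IsFiniteMeasure (cubeMeasure N) := by
  refine ⟨?_⟩
  rw [cubeMeasure, Measure.restrict_apply_univ]
  exact (measure_mono (unitCube_subset_Icc N)).trans_lt (isCompact_bigCube N).measure_lt_top

theorem memLp_of_continuous (N : ℕ) {F : Type*} [NormedAddCommGroup F]
    [SecondCountableTopology F] {f : EuclideanSpace ℝ (Fin N) → F} (hf : Continuous f) (p : ℝ≥0∞) :
    MemLp f p (cubeMeasure N) := by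
  obtain ⟨C, hC⟩ := (isCompact_bigCube N).exists_bound_of_continuousOn hf.continuousOn
  refine MemLp.of_bound hf.aestronglyMeasurable C ?_
  rw [cubeMeasure, ae_restrict_iff' (isOpen_unitCube N).measurableSet]
  exact Eventually.of_forall fun y hy => hC y (unitCube_subset_Icc N hy)

theorem integrable_mul_of_continuous (N : ℕ) {f g : EuclideanSpace ℝ (Fin N) → ℝ}
    (hf : Integrable f (cubeMeasure N)) (hg : Continuous g) :
    Integrable (fun y => f y * g y) (cubeMeasure N) := by
  have := memLp_of_continuous N hg ∞
  exact hf.mul_of_top_left this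

theorem integrable_coord {m N : ℕ} {p : ℝ≥0∞} [hp : Fact (1 ≤ p)]
    (v : Lp (EuclideanSpace ℝ (Fin m)) p (cubeMeasure N)) (i : Fin m) :
    Integrable (fun y => v y i) (cubeMeasure N) := by
  have h : Integrable (v : EuclideanSpace ℝ (Fin N) → _) (cubeMeasure N) :=
    (Lp.memLp v).integrable hp.out
  exact (EuclideanSpace.proj (𝕜 := ℝ) i).integrable_comp h

theorem integrable_entry {m N : ℕ} {p : ℝ≥0∞} [hp : Fact (1 ≤ p)]
    (G : Lp (Mat m N) p (cubeMeasure N)) (i : Fin m) (j : Fin N) :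
    Integrable (fun y => G y (i, j)) (cubeMeasure N) := by
  have h : Integrable (G : EuclideanSpace ℝ (Fin N) → _) (cubeMeasure N) :=
    (Lp.memLp G).integrable hp.out
  exact (EuclideanSpace.proj (𝕜 := ℝ) (i, j)).integrable_comp h

theorem IsTestFunction.continuous_partial {N : ℕ} {φ : EuclideanSpace ℝ (Fin N) → ℝ}
    (hφ : IsTestFunction N φ) (x : EuclideanSpace ℝ (Fin N)) :
    Continuous fun y => fderiv ℝ φ y x :=
  (hφ.1.continuous_fderiv (by simp)).clm_apply continuous_const

/-- The Sobolev space `W^{1,p}(Y; ℝ^m)`: the space of all pairs `(v, ∇v)` with `v ∈ L^p(Y; ℝ^m)`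
and distributional gradient `∇v ∈ L^p(Y; 𝕄)`.  As a subspace of `L^p × L^p` it carries
the norm `max (‖v‖_p) (‖∇v‖_p)`, which is equivalent to the usual ones. -/
noncomputable def W1p (m N : ℕ) (p : ℝ≥0∞) [Fact (1 ≤ p)] :
    Submodule ℝ (Lp (EuclideanSpace ℝ (Fin m)) p (cubeMeasure N) ×
      Lp (Mat m N) p (cubeMeasure N)) where
  carrier := {u | IsWeakGradient m N u.1 u.2}
  zero_mem' := by
    intro φ _ i j
    have h1 : (fun y => (0 : Lp (EuclideanSpace ℝ (Fin m)) p (cubeMeasure N)) y i *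
          fderiv ℝ φ y (EuclideanSpace.single j 1)) =ᵐ[cubeMeasure N] fun _ => 0 := by
      filter_upwards [Lp.coeFn_zero (EuclideanSpace ℝ (Fin m)) p (cubeMeasure N)] with y hy
      rw [hy]; simp
    have h2 : (fun y => (0 : Lp (Mat m N) p (cubeMeasure N)) y (i, j) * φ y)
        =ᵐ[cubeMeasure N] fun _ => 0 := by
      filter_upwards [Lp.coeFn_zero (Mat m N) p (cubeMeasure N)] with y hy
      rw [hy]; simp
    simp only [Prod.fst_zero, Prod.snd_zero]
    rw [integral_congr_ae h1, integral_congr_ae h2]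
    simp
  add_mem' := by
    intro u w hu hw φ hφ i j
    have e1 : ∫ y, (u + w).1 y i * fderiv ℝ φ y (EuclideanSpace.single j 1) ∂cubeMeasure N
        = ∫ y, (u.1 y i * fderiv ℝ φ y (EuclideanSpace.single j 1) +
            w.1 y i * fderiv ℝ φ y (EuclideanSpace.single j 1)) ∂cubeMeasure N := by
      refine integral_congr_ae ?_
      filter_upwards [Lp.coeFn_add u.1 w.1] with y hy
      simp only [Prod.fst_add, hy, Pi.add_apply, PiLp.add_apply, add_mul]
    have e2 : ∫ y, (u + w).2 y (i, j) * φ y ∂cubeMeasure N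
        = ∫ y, (u.2 y (i, j) * φ y + w.2 y (i, j) * φ y) ∂cubeMeasure N := by
      refine integral_congr_ae ?_
      filter_upwards [Lp.coeFn_add u.2 w.2] with y hy
      simp only [Prod.snd_add, hy, Pi.add_apply, PiLp.add_apply, add_mul]
    have hc := hφ.continuous_partial (EuclideanSpace.single j 1)
    have hφc := hφ.1.continuous
    rw [e1, e2, integral_add (integrable_mul_of_continuous N (integrable_coord u.1 i) hc)
      (integrable_mul_of_continuous N (integrable_coord w.1 i) hc),
      integral_add (integrable_mul_of_continuous N (integrable_entry u.2 i j) hφc)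
      (integrable_mul_of_continuous N (integrable_entry w.2 i j) hφc), hu φ hφ i j, hw φ hφ i j]
    ring
  smul_mem' := by
    intro c u hu φ hφ i j
    have e1 : ∫ y, (c • u).1 y i * fderiv ℝ φ y (EuclideanSpace.single j 1) ∂cubeMeasure N
        = ∫ y, c * (u.1 y i * fderiv ℝ φ y (EuclideanSpace.single j 1)) ∂cubeMeasure N := by
      refine integral_congr_ae ?_
      filter_upwards [Lp.coeFn_smul c u.1] with y hy
      simp [hy, mul_assoc]
    have e2 : ∫ y, (c • u).2 y (i, j) * φ y ∂cubeMeasure N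
        = ∫ y, c * (u.2 y (i, j) * φ y) ∂cubeMeasure N := by
      refine integral_congr_ae ?_
      filter_upwards [Lp.coeFn_smul c u.2] with y hy
      simp [hy, mul_assoc]
    rw [e1, e2, integral_const_mul, integral_const_mul, hu φ hφ i j]
    ring

/-- The value (an a.e. class) of a Sobolev function. -/
noncomputable def W1p.val {m N : ℕ} {p : ℝ≥0∞} [Fact (1 ≤ p)] (u : W1p m N p) :
    EuclideanSpace ℝ (Fin N) → EuclideanSpace ℝ (Fin m) := u.1.1

/-- The gradient `∇u` (an a.e. class) of a Sobolev function. -/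
noncomputable def W1p.grad {m N : ℕ} {p : ℝ≥0∞} [Fact (1 ≤ p)] (u : W1p m N p) :
    EuclideanSpace ℝ (Fin N) → Mat m N := u.1.2

/-- `W^{1,p}_0(Y; ℝ^m)`: the closure of `C_c^∞(Y; ℝ^m)` in `W^{1,p}(Y; ℝ^m)`
(used for `p < ∞` only). -/
def W1p0 (m N : ℕ) (p : ℝ≥0∞) [Fact (1 ≤ p)] : Set (W1p m N p) :=
  closure {u | ∃ φ : EuclideanSpace ℝ (Fin N) → EuclideanSpace ℝ (Fin m),
    IsTestFunction N φ ∧ W1p.val u =ᵐ[cubeMeasure N] φ}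

/-- The linear map `l_ξ(y) = ξ y`. -/
noncomputable def linFun {m N : ℕ} (ξ : Mat m N) :
    EuclideanSpace ℝ (Fin N) → EuclideanSpace ℝ (Fin m) :=
  fun y => WithLp.toLp 2 fun i => ∑ j, ξ (i, j) * y j

theorem continuous_linFun {m N : ℕ} (ξ : Mat m N) : Continuous (linFun ξ) :=
  (PiLp.continuous_toLp 2 _).comp (by fun_prop)

theorem isWeakGradient_linFun {m N : ℕ} (ξ : Mat m N) :
    IsWeakGradient m N (linFun ξ) (fun _ => ξ) := by
  intro φ hφ i j
  let T : EuclideanSpace ℝ (Fin N) →L[ℝ] ℝ :=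
    ∑ k, ξ (i, k) • EuclideanSpace.proj (𝕜 := ℝ) k
  have hT : ∀ y, linFun ξ y i = T y := by
    intro y
    simp [T, linFun]
  have hTj : T (EuclideanSpace.single j 1) = ξ (i, j) := by
    simp [T]
  set e : EuclideanSpace ℝ (Fin N) := EuclideanSpace.single j 1 with he
  have hout : ∀ y, y ∉ unitCube N → φ y = 0 := fun y hy =>
    image_eq_zero_of_notMem_tsupport fun h => hy (hφ.2.2 h)
  have hout' : ∀ y, y ∉ unitCube N → fderiv ℝ φ y e = 0 := by
    intro y hy
    have : fderiv ℝ φ y = 0 := image_eq_zero_of_notMem_tsupport fun h =>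
      hy (hφ.2.2 (tsupport_fderiv_subset ℝ h))
    simp [this]
  have hc := hφ.continuous_partial e
  have hsupp : HasCompactSupport fun y => fderiv ℝ φ y e := hφ.2.1.fderiv_apply ℝ e
  have i1 : Integrable (fun y => fderiv ℝ (fun y => T y) y e * φ y) := by
    simp only [ContinuousLinearMap.fderiv]
    exact (hφ.1.continuous.integrable_of_hasCompactSupport hφ.2.1).const_mul _
  have i2 : Integrable (fun y => T y * fderiv ℝ φ y e) :=
    (T.continuous.mul hc).integrable_of_hasCompactSupport hsupp.mul_left
  have i3 : Integrable (fun y => T y * φ y) :=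
    (T.continuous.mul hφ.1.continuous).integrable_of_hasCompactSupport hφ.2.1.mul_left
  have key := integral_mul_fderiv_eq_neg_fderiv_mul_of_integrable (μ := volume) (𝕜 := ℝ) (v := e)
    i1 i2 i3 (fun x _ => T.differentiable x)
    (fun x _ => hφ.1.differentiable (by simp) x)
  simp only [ContinuousLinearMap.fderiv, hTj] at key
  simp only [hT, cubeMeasure]
  rw [setIntegral_eq_integral_of_forall_compl_eq_zero (fun y hy => by simp [hout' y hy]),
    setIntegral_eq_integral_of_forall_compl_eq_zero (fun y hy => by simp [hout y hy])]
  exact key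

/-- `l_ξ` as an element of `W^{1,p}(Y; ℝ^m)`; its gradient is the constant `ξ`. -/
noncomputable def linW (m N : ℕ) (p : ℝ≥0∞) [Fact (1 ≤ p)] (ξ : Mat m N) :
    W1p m N p :=
  ⟨((memLp_of_continuous N (continuous_linFun ξ) p).toLp _,
    (memLp_of_continuous N (continuous_const (y := ξ)) p).toLp _), by
    intro φ hφ i j
    have h := isWeakGradient_linFun ξ φ hφ i j
    have e1 := (memLp_of_continuous N (continuous_linFun ξ) p).coeFn_toLp
    have e2 := (memLp_of_continuous N (continuous_const (y := ξ)) p).coeFn_toLp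
    refine (integral_congr_ae ?_).trans (h.trans (congrArg Neg.neg (integral_congr_ae ?_)))
    · filter_upwards [e1] with y hy
      simp only [hy]
    · filter_upwards [e2] with y hy
      simp only [hy]⟩

/-- Weak convergence `u_n ⇀ u` in a normed space. -/
def WeaklyConverges {X : Type*} [NormedAddCommGroup X] [NormedSpace ℝ X] (u : ℕ → X) (x : X) :
    Prop :=
  ∀ f : X →L[ℝ] ℝ, Tendsto (fun n => f (u n)) atTop (𝓝 (f x))

/-- Equi-integrability of a sequence of `[0,∞]`-valued functions.  (On the cube `Y`, a finite
nonatomic measure space, this includes boundedness of the integrals.) -/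
def EquiIntegrable {α : Type*} [MeasurableSpace α] (μ : Measure α) (f : ℕ → α → ℝ≥0∞) : Prop :=
  ∀ η : ℝ≥0∞, 0 < η → ∃ δ : ℝ≥0∞, 0 < δ ∧
    ∀ A : Set α, MeasurableSet A → μ A ≤ δ → ∀ n, ∫⁻ y in A, f n y ∂μ ≤ η

/-- The localization principle `(C_{p,p})` for the integrand `L`. -/
def LocalizationPrinciple (m N : ℕ) (L : Mat m N → ℝ≥0∞)
    (p : ℝ≥0∞) [Fact (1 ≤ p)] : Prop :=
  ∀ (ξ : Mat m N) (v : ℕ → W1p m N p),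
    WeaklyConverges v (linW m N p ξ) →
    (⨆ n, ∫⁻ y, L (W1p.grad (v n) y) ∂cubeMeasure N) < ∞ →
    ∃ (σ : ℕ → ℕ) (w : ℕ → W1p m N p), StrictMono σ ∧
      (∀ n, w n - linW m N p ξ ∈ W1p0 m N p) ∧
      TendstoInMeasure (cubeMeasure N) (fun n y => ‖W1p.grad (v (σ n)) y - W1p.grad (w n) y‖) atTop
        (fun _ => (0 : ℝ)) ∧
      EquiIntegrable (cubeMeasure N) (fun n y => L (W1p.grad (w n) y))

end LocPrinciple

namespace LocPrinciple

/-! ### Equi-integrability and a truncated biting lemma -/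

section EquiIntegrability

variable {α : Type*} [MeasurableSpace α] {μ : Measure α}

/-! Write `f_n = L(∇v_n)`. For small `δ` the competitor is `w = l_ξ - (1 - l) ψ l_ξ + l φ (v_n -
l_ξ)`, where `l = r l'` is slightly below 1, `φ = 1` on a compact set `K` that nearly fills the
cube, `φ` vanishes off an open `U ⊇ K`, and `ψ = 1` on the closure of `U`. It lies in `l_ξ +
W^{1,p}_0` because both corrections have compact support in the cube.

Everything is compared with `L(l' ∇v_n)`. Where `|∇v_n| ≥ R`, (D₁) gives `L(l' ∇v_n) ≤ δ f_n`; where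
`|∇v_n| < R`, `f_n` is below a constant `k₀` and (D₂) applies. Hence `L(l' ∇v_n) ≤ α₁ (1 + min(f_n,
k₀)) + δ f_n`. On `K` the gradient of `w` is `r l' ∇v_n`, and (D₂) removes `r`. Off `U` it is
bounded by `|ξ| + 1`. In the layer `U \ K` it is `r l' ξ + s (l' ∇v_n - r l' ξ) + e` with `0 ≤ s ≤ r
< 1`, and (D₃) bounds `L` there by `L(l' ∇v_n)`, up to a constant `M` on a set of measure at most `δ
/ (M + 1)`. The error `e` contains `(v_n - l_ξ) ⊗ ∇φ`, which must be uniformly small. This is where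
`p > N` enters: Morrey's inequality, with convergence of averages over finitely many balls, turns
weak convergence into local uniform convergence.

The outcome (`exists_competitor`) is `L(∇w) ≤ A (1 + min(f_n, k₀)) + A δ f_n + g` with `∫ g ≤ δ` and
`A` independent of `δ`. Let `δ = 1/(j+1)`. By the truncated biting lemma
(`exists_strictMono_equiIntegrable_min`) the truncations are equi-integrable along a subsequence,
while the remainder tends to zero in `L^1`; `EquiIntegrable.of_le_affine_add` concludes. Convergence
in measure holds because `|∇v_n - ∇w| ≤ δ |∇v_n|` on `K`, with `∇v_n` bounded in `L^1`. -/

theorem exists_strictMono_min_mass_tendsto (f : ℕ → α → ℝ≥0∞) :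
    ∃ (τ : ℕ → ℕ) (g : ℕ → ℝ≥0∞), StrictMono τ ∧
      ∀ J : ℕ, Tendsto (fun k => ∫⁻ y, min (f (τ k) y) J ∂μ) atTop (𝓝 (g J)) := by
  -- Sequential compactness of the countable product of copies of `[0,∞]` replaces a diagonal
  -- extraction.
  obtain ⟨g, -, τ, hτ, hg⟩ := (isCompact_univ (X := ℕ → ℝ≥0∞)).tendsto_subseq
    (x := fun n J => ∫⁻ y, min (f n y) (J : ℕ) ∂μ) (fun n => mem_univ _)
  exact ⟨τ, g, hτ, fun J => (tendsto_pi_nhds.1 hg J)⟩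

/-- The truncated form of the biting lemma. -/
theorem exists_strictMono_equiIntegrable_min [IsFiniteMeasure μ] {f : ℕ → α → ℝ≥0∞} {C : ℝ≥0∞}
    (hC : C ≠ ∞) (hm : ∀ n, AEMeasurable (f n) μ) (hf : ∀ n, ∫⁻ y, f n y ∂μ ≤ C) :
    ∃ τ : ℕ → ℕ, StrictMono τ ∧ EquiIntegrable μ (fun k y => min (f (τ k) y) (k : ℝ≥0∞)) := by
  obtain ⟨τ, g, hτ, hg⟩ := exists_strictMono_min_mass_tendsto (μ := μ) f
  have hgC : ∀ J, g J ≤ C := fun J => le_of_tendsto' (hg J) fun k =>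
    (lintegral_mono fun y => min_le_left _ _).trans (hf _)
  have hgmono : Monotone g := fun J J' h => le_of_tendsto_of_tendsto' (hg J) (hg J') fun k =>
    lintegral_mono fun y => min_le_min_left _ (by exact_mod_cast h)
  have hgtop : ∀ J, g J ≠ ∞ := fun J => ((hgC J).trans_lt hC.lt_top).ne
  set G := ⨆ J, g J with hG
  have hGtop : G ≠ ∞ := ((iSup_le hgC).trans_lt hC.lt_top).ne
  have hgG : Tendsto g atTop (𝓝 G) := tendsto_atTop_iSup hgmono
  -- choose a subsequence along which the truncated masses converge to `G`
  have hex : ∀ k : ℕ, ∀ᶠ n in atTop, ∫⁻ y, min (f (τ n) y) (k : ℝ≥0∞) ∂μ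
      ≤ g k + (k + 1 : ℝ≥0∞)⁻¹ := by
    intro k
    refine (hg k).eventually_le_const ?_
    exact ENNReal.lt_add_right (hgtop k) (by simp)
  obtain ⟨ρ, hρ, hρ'⟩ := extraction_forall_of_eventually hex
  refine ⟨τ ∘ ρ, hτ.comp hρ, ?_⟩
  intro η hη
  by_cases hηtop : η = ∞
  · exact ⟨1, one_pos, fun A _ _ n => by simp [hηtop]⟩
  set h : ℕ → α → ℝ≥0∞ := fun k y => min (f ((τ ∘ ρ) k) y) (k : ℝ≥0∞) with hh
  have h4 : 0 < η / 4 := ENNReal.div_pos hη.ne' (by simp)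
  have h4top : η / 4 ≠ ∞ := ENNReal.div_ne_top hηtop (by simp)
  obtain ⟨J, hJ⟩ : ∃ J : ℕ, G ≤ g J + η / 4 := by
    by_cases hG0 : G = 0
    · exact ⟨0, by simp [hG0]⟩
    have : ∀ᶠ J in atTop, G - η / 4 < g J :=
      hgG.eventually_const_lt (ENNReal.sub_lt_self hGtop hG0 h4.ne')
    obtain ⟨J, hJ⟩ := this.exists
    exact ⟨J, tsub_le_iff_right.1 hJ.le⟩
  have hev : ∀ᶠ k : ℕ in atTop, g J ≤ ∫⁻ y, min (f ((τ ∘ ρ) k) y) (J : ℝ≥0∞) ∂μ + η / 4 ∧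
      (k + 1 : ℝ≥0∞)⁻¹ ≤ η / 4 ∧ J ≤ k := by
    refine Eventually.and ?_ (Eventually.and ?_ (eventually_ge_atTop J))
    · have h1 := (hg J).comp hρ.tendsto_atTop
      by_cases h0 : g J = 0
      · simp [h0]
      filter_upwards [h1.eventually_const_lt (ENNReal.sub_lt_self (hgtop J) h0 h4.ne')] with k hk
      exact tsub_le_iff_right.1 hk.le
    · have : Tendsto (fun k : ℕ => (k + 1 : ℝ≥0∞)⁻¹) atTop (𝓝 0) := by
        have := (ENNReal.tendsto_inv_nat_nhds_zero).comp (tendsto_add_atTop_nat 1)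
        refine this.congr fun k => ?_
        simp
      exact this.eventually_le_const h4
  obtain ⟨k₀, hk₀⟩ := eventually_atTop.1 hev
  -- `T` bounds the level `J` and also the finitely many initial functions `h k`, `k ≤ k₀`, since `h
  -- k ≤ k`. Later `k` are split at level `J`.
  set T : ℝ≥0∞ := ((max J k₀ : ℕ) : ℝ≥0∞) with hT
  refine ⟨η / 4 / (T + 1), ENNReal.div_pos h4.ne' (by simp [hT]), fun A hA hμA k => ?_⟩
  have hTA : T * μ A ≤ η / 4 := by
    calc T * μ A ≤ (T + 1) * (η / 4 / (T + 1)) := by gcongr; exact le_self_add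
      _ ≤ η / 4 := ENNReal.mul_div_le
  have hmin : ∀ n : ℕ, n ≤ max J k₀ → ∫⁻ y in A, min (f ((τ ∘ ρ) k) y) (n : ℝ≥0∞) ∂μ ≤ η / 4 := by
    intro n hn
    calc ∫⁻ y in A, min (f ((τ ∘ ρ) k) y) (n : ℝ≥0∞) ∂μ ≤ ∫⁻ y in A, T ∂μ := by
          refine lintegral_mono fun y => (min_le_right _ _).trans ?_
          exact Nat.cast_le.2 hn
      _ = T * μ A := by simp
      _ ≤ _ := hTA
  rcases le_or_gt k k₀ with hk | hk
  · exact (hmin k (hk.trans (le_max_right _ _))).trans (ENNReal.div_le_of_le_mul (le_mul_of_one_le_right' (by norm_num)))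
  obtain ⟨e1, e2, e3⟩ := hk₀ k hk.le
  have mJ : AEMeasurable (fun y => min (f ((τ ∘ ρ) k) y) (J : ℝ≥0∞)) μ :=
    (hm _).min aemeasurable_const
  have hle : ∀ y, min (f ((τ ∘ ρ) k) y) (J : ℝ≥0∞) ≤ h k y := fun y =>
    min_le_min_left _ (by exact_mod_cast e3)
  -- The mass between levels `J` and `k` is small: the mass below `k` is almost at most `G`, the
  -- mass below `J` is almost at least `g J`, and `g J` is almost `G`.
  have hsub : ∫⁻ y, (h k y - min (f ((τ ∘ ρ) k) y) (J : ℝ≥0∞)) ∂μ ≤ η / 4 + (η / 4 + η / 4) := by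
    rw [lintegral_sub' mJ (((lintegral_mono fun y => min_le_left _ _).trans
      (hf _)).trans_lt hC.lt_top).ne (Eventually.of_forall hle)]
    rw [tsub_le_iff_left]
    calc ∫⁻ y, h k y ∂μ ≤ g k + (k + 1 : ℝ≥0∞)⁻¹ := hρ' k
      _ ≤ G + η / 4 := by gcongr; exact le_iSup g k
      _ ≤ ((∫⁻ y, min (f ((τ ∘ ρ) k) y) (J : ℝ≥0∞) ∂μ + η / 4) + η / 4) + η / 4 := by
        gcongr; exact hJ.trans (by gcongr)
      _ = _ := by ring
  calc ∫⁻ y in A, h k y ∂μ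
      = ∫⁻ y in A, (min (f ((τ ∘ ρ) k) y) (J : ℝ≥0∞) +
          (h k y - min (f ((τ ∘ ρ) k) y) (J : ℝ≥0∞))) ∂μ :=
        lintegral_congr fun y => (add_tsub_cancel_of_le (hle y)).symm
    _ = ∫⁻ y in A, min (f ((τ ∘ ρ) k) y) (J : ℝ≥0∞) ∂μ +
          ∫⁻ y in A, (h k y - min (f ((τ ∘ ρ) k) y) (J : ℝ≥0∞)) ∂μ :=
        lintegral_add_left' mJ.restrict _
    _ ≤ η / 4 + (η / 4 + (η / 4 + η / 4)) :=
        add_le_add (hmin J (le_max_left _ _)) ((setLIntegral_le_lintegral _ _).trans hsub)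
    _ = 4 * (η / 4) := by ring
    _ = η := ENNReal.mul_div_cancel (by simp) (by simp)

theorem EquiIntegrable.comp {f : ℕ → α → ℝ≥0∞} (hf : EquiIntegrable μ f) (σ : ℕ → ℕ) :
    EquiIntegrable μ (fun n => f (σ n)) := by
  intro η hη
  obtain ⟨δ, hδ, h⟩ := hf η hη
  exact ⟨δ, hδ, fun A hA hμ n => h A hA hμ _⟩

/-- A remainder tending to zero in `L^1` is equi-integrable: its tail is uniformly small, and the
finitely many other terms are handled by absolute continuity of their integrals. -/
theorem EquiIntegrable.of_le_affine_add [IsFiniteMeasure μ] {F h g : ℕ → α → ℝ≥0∞} {c : ℝ≥0∞}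
    (hc : c ≠ ∞) (hh : EquiIntegrable μ h) (hhm : ∀ n, AEMeasurable (h n) μ)
    (hg : Tendsto (fun n => ∫⁻ y, g n y ∂μ) atTop (𝓝 0)) (hg' : ∀ n, ∫⁻ y, g n y ∂μ ≠ ∞)
    (hF : ∀ n, ∀ᵐ y ∂μ, F n y ≤ c * (1 + h n y) + g n y) : EquiIntegrable μ F := by
  intro η hη
  have h3 : 0 < η / 3 := ENNReal.div_pos hη.ne' (by simp)
  have hc3 : 0 < η / 3 / (c + 1) := ENNReal.div_pos h3.ne' (by simp [hc])
  obtain ⟨δ₁, hδ₁, H₁⟩ := hh _ hc3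
  obtain ⟨n₀, hn₀⟩ := eventually_atTop.1 (hg.eventually_le_const h3)
  have hsingle : ∀ n, ∃ δ : ℝ≥0∞, 0 < δ ∧ ∀ A, μ A < δ → ∫⁻ y in A, g n y ∂μ < η / 3 := by
    intro n
    obtain ⟨δ, hδ, H⟩ := exists_pos_setLIntegral_lt_of_measure_lt (hg' n) h3.ne'
    exact ⟨δ, hδ, H⟩
  choose d hd Hd using hsingle
  have hdmin : ∃ δ₂ : ℝ≥0∞, 0 < δ₂ ∧ ∀ n < n₀, δ₂ < d n := by
    have : ∀ᶠ x in 𝓝[>] (0 : ℝ≥0∞), ∀ n ∈ Finset.range n₀, x < d n := by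
      rw [Filter.eventually_all_finset]
      intro n _
      exact nhdsWithin_le_nhds (eventually_lt_nhds (hd n))
    obtain ⟨x, hx, hx0⟩ := (this.and self_mem_nhdsWithin).exists
    exact ⟨x, hx0, fun n hn => hx n (Finset.mem_range.2 hn)⟩
  obtain ⟨δ₂, hδ₂, H₂⟩ := hdmin
  refine ⟨min (η / 3 / (c + 1)) (min δ₁ δ₂), lt_min hc3 (lt_min hδ₁ hδ₂), fun A hA hμ n => ?_⟩
  have hgA : ∫⁻ y in A, g n y ∂μ ≤ η / 3 := by
    rcases lt_or_ge n n₀ with hn | hn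
    · exact (Hd n A ((hμ.trans ((min_le_right _ _).trans (min_le_right _ _))).trans_lt
        (H₂ n hn))).le
    · exact (setLIntegral_le_lintegral _ _).trans (hn₀ n hn)
  have hmul : ∀ x : ℝ≥0∞, x ≤ η / 3 / (c + 1) → c * x ≤ η / 3 := fun x hx =>
    calc c * x ≤ (c + 1) * (η / 3 / (c + 1)) := by gcongr; exact le_self_add
      _ ≤ η / 3 := ENNReal.mul_div_le
  calc ∫⁻ y in A, F n y ∂μ ≤ ∫⁻ y in A, (c * (1 + h n y) + g n y) ∂μ :=
        lintegral_mono_ae (ae_restrict_of_ae (hF n))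
    _ = ∫⁻ y in A, c * (1 + h n y) ∂μ + ∫⁻ y in A, g n y ∂μ :=
        lintegral_add_left' ((aemeasurable_const.add (hhm n)).const_mul c).restrict _
    _ = (c * μ A + c * ∫⁻ y in A, h n y ∂μ) + ∫⁻ y in A, g n y ∂μ := by
        rw [lintegral_const_mul' _ _ hc, lintegral_add_left' aemeasurable_const]
        simp [mul_add]
    _ ≤ (η / 3 + η / 3) + η / 3 := by
        refine add_le_add (add_le_add (hmul _ (hμ.trans (min_le_left _ _))) (hmul _ ?_)) hgA
        exact H₁ A hA (hμ.trans ((min_le_right _ _).trans (min_le_left _ _))) n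
    _ = 3 * (η / 3) := by ring
    _ = η := ENNReal.mul_div_cancel (by simp) (by simp)

end EquiIntegrability

/-! ### Morrey's inequality for smooth functions -/

section Morrey

open Module

theorem enorm_sub_le_lintegral_fderiv {E F : Type*} [NormedAddCommGroup E] [NormedSpace ℝ E]
    [NormedAddCommGroup F] [NormedSpace ℝ F] {f : E → F} (hf : ContDiff ℝ 1 f) (x y : E) :
    ‖f y - f x‖ₑ ≤ ∫⁻ t in Ioc (0 : ℝ) 1, ‖fderiv ℝ f (x + t • (y - x))‖ₑ * ‖y - x‖ₑ := by
  -- The fundamental theorem of calculus needs a complete target; the isometric embedding into the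
  -- completion leaves the norms unchanged.
  let F' := UniformSpace.Completion F
  let ι : F →L[ℝ] F' := UniformSpace.Completion.toComplL
  have hd : ∀ t : ℝ, HasDerivAt (fun t : ℝ => ι (f (x + t • (y - x))))
      (ι (fderiv ℝ f (x + t • (y - x)) (y - x))) t := by
    intro t
    have h1 : HasDerivAt (fun t : ℝ => x + t • (y - x)) (y - x) t := by
      simpa using ((hasDerivAt_id t).smul_const (y - x)).const_add x
    have h2 := ((hf.differentiable one_ne_zero) (x + t • (y - x))).hasFDerivAt
    exact ι.hasFDerivAt.comp_hasDerivAt t (h2.comp_hasDerivAt t h1)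
  have hc : Continuous fun t : ℝ => ι (fderiv ℝ f (x + t • (y - x)) (y - x)) := by
    refine ι.continuous.comp (Continuous.clm_apply ?_ continuous_const)
    exact (hf.continuous_fderiv one_ne_zero).comp (by fun_prop)
  have hint := intervalIntegral.integral_eq_sub_of_hasDerivAt (a := 0) (b := 1)
    (fun t _ => hd t) (hc.intervalIntegrable 0 1)
  have hnorm : ∀ z : F, ‖ι z‖ₑ = ‖z‖ₑ := fun z => by
    rw [enorm_eq_iff_norm_eq]; exact UniformSpace.Completion.norm_coe z
  have e : ‖f y - f x‖ₑ = ‖∫ t in (0 : ℝ)..1, ι (fderiv ℝ f (x + t • (y - x)) (y - x))‖ₑ := by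
    rw [hint, ← map_sub, hnorm]; simp
  rw [e, intervalIntegral.integral_of_le zero_le_one]
  refine (enorm_integral_le_lintegral_enorm _).trans (lintegral_mono fun t => ?_)
  rw [hnorm]
  exact ContinuousLinearMap.le_opENorm _ _

variable {E F : Type*} [NormedAddCommGroup E] [NormedSpace ℝ E] [FiniteDimensional ℝ E]
  [MeasurableSpace E] [BorelSpace E] {μ : Measure E} [μ.IsAddHaarMeasure]
  [NormedAddCommGroup F] [NormedSpace ℝ F]

/-- The Jacobian `t^(-n)` computed here, raised to the power `1/q`, becomes the integrand of
`morreyConst`. -/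
theorem lintegral_comp_homothety (x : E) {t : ℝ} (ht : 0 < t) {g : E → ℝ≥0∞}
    (hg : Measurable g) :
    ∫⁻ y, g (x + t • (y - x)) ∂μ = ENNReal.ofReal ((t ^ finrank ℝ E)⁻¹) * ∫⁻ y, g y ∂μ := by
  have h1 : ∀ y, x + t • (y - x) = t • y + (x - t • x) := fun y => by
    rw [smul_sub]; abel
  have h2 : ∫⁻ y, g (t • y + (x - t • x)) ∂μ
      = ∫⁻ z, g (z + (x - t • x)) ∂(Measure.map (t • ·) μ) := by
    rw [lintegral_map (f := fun z => g (z + (x - t • x))) (by fun_prop) (by fun_prop)]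
  simp only [h1]
  rw [h2, Measure.map_addHaar_smul μ ht.ne', lintegral_smul_measure,
    lintegral_add_right_eq_self (fun z => g z) (x - t • x), abs_of_pos (by positivity), smul_eq_mul]

/-- The constant `∫₀¹ t^(-n/q) dt` in Morrey's inequality. -/
noncomputable def morreyConst (n : ℕ) (q : ℝ) : ℝ≥0∞ :=
  ∫⁻ t in Ioc (0 : ℝ) 1, ENNReal.ofReal ((t ^ n)⁻¹) ^ (1 / q)

/-- `t^(-n/q)` is integrable at zero because `n/q < 1`. -/
theorem morreyConst_lt_top {n : ℕ} {q : ℝ} (hq : (n : ℝ) < q) : morreyConst n q < ∞ := by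
  have hq0 : 0 < q := (Nat.cast_nonneg n).trans_lt hq
  have h1 : -1 < -(n / q : ℝ) := by
    rw [neg_lt_neg_iff, div_lt_one hq0]; exact hq
  have h2 : IntegrableOn (fun t : ℝ => t ^ (-(n / q : ℝ))) (Ioc 0 1) :=
    (intervalIntegrable_iff_integrableOn_Ioc_of_le zero_le_one).1
      (intervalIntegral.intervalIntegrable_rpow' h1)
  refine lt_of_le_of_lt ?_ h2.2
  refine setLIntegral_mono' measurableSet_Ioc fun t ht => ?_
  rw [ENNReal.ofReal_rpow_of_nonneg (inv_nonneg.2 (pow_nonneg ht.1.le n)) (by positivity),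
    Real.enorm_eq_ofReal (Real.rpow_nonneg ht.1.le _)]
  refine ENNReal.ofReal_le_ofReal (le_of_eq ?_)
  rw [← Real.rpow_natCast, ← Real.rpow_neg ht.1.le, ← Real.rpow_mul ht.1.le]
  congr 1; ring

/-- Morrey's inequality for `C^1` functions, in integrated form. -/
theorem lintegral_enorm_sub_le_morrey {f : E → F} (hf : ContDiff ℝ 1 f) {q : ℝ} (hq : 1 ≤ q)
    {B : Set E} (hB : MeasurableSet B) {d : ℝ≥0∞} {x : E} (hd : ∀ y ∈ B, ‖y - x‖ₑ ≤ d) :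
    ∫⁻ y in B, ‖f y - f x‖ₑ ∂μ ≤ d * μ B ^ (1 - 1 / q) * morreyConst (finrank ℝ E) q *
      (∫⁻ y, ‖fderiv ℝ f y‖ₑ ^ q ∂μ) ^ (1 / q) := by
  set g : E → ℝ≥0∞ := fun y => ‖fderiv ℝ f y‖ₑ with hg
  have hgc : Continuous g := (hf.continuous_fderiv one_ne_zero).enorm
  have hgm : Measurable g := hgc.measurable
  have hq0 : 0 < q := one_pos.trans_le hq
  -- At fixed `t`: Hölder on `B`, then the homothety centred at `x`, with the integral enlarged from
  -- `B` to the whole space.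
  have inner : ∀ t ∈ Ioc (0 : ℝ) 1, ∫⁻ y in B, g (x + t • (y - x)) ∂μ ≤
      μ B ^ (1 - 1 / q) * (∫⁻ y, g y ^ q ∂μ) ^ (1 / q) *
        ENNReal.ofReal ((t ^ finrank ℝ E)⁻¹) ^ (1 / q) := by
    intro t ht
    have hm : Measurable fun y => g (x + t • (y - x)) := by fun_prop
    have holder : ∫⁻ y in B, g (x + t • (y - x)) ∂μ ≤
        (∫⁻ y in B, g (x + t • (y - x)) ^ q ∂μ) ^ (1 / q) * μ B ^ (1 - 1 / q) := by
      rcases hq.eq_or_lt with rfl | hq1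
      · simp
      have hc := Real.HolderConjugate.conjExponent hq1
      have := ENNReal.lintegral_mul_le_Lp_mul_Lq (μ.restrict B) hc hm.aemeasurable
        (aemeasurable_const (b := (1 : ℝ≥0∞)))
      simpa [← hc.one_sub_inv] using this
    refine holder.trans ?_
    have : ∫⁻ y in B, g (x + t • (y - x)) ^ q ∂μ ≤
        ENNReal.ofReal ((t ^ finrank ℝ E)⁻¹) * ∫⁻ y, g y ^ q ∂μ := by
      rw [← lintegral_comp_homothety x ht.1 (hgm.pow_const q)]
      exact setLIntegral_le_lintegral _ _
    calc _ ≤ (ENNReal.ofReal ((t ^ finrank ℝ E)⁻¹) * ∫⁻ y, g y ^ q ∂μ) ^ (1 / q) *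
          μ B ^ (1 - 1 / q) := by gcongr
      _ = _ := by rw [ENNReal.mul_rpow_of_nonneg _ _ (by positivity)]; ring
  have hswap : ∫⁻ y in B, (∫⁻ t in Ioc (0 : ℝ) 1, g (x + t • (y - x)) * d) ∂μ =
      ∫⁻ t in Ioc (0 : ℝ) 1, (∫⁻ y in B, g (x + t • (y - x)) * d ∂μ) := by
    refine lintegral_lintegral_swap (Measurable.aemeasurable ?_)
    refine Measurable.mul_const (Continuous.measurable ?_) d
    exact hgc.comp (by fun_prop)
  calc ∫⁻ y in B, ‖f y - f x‖ₑ ∂μ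
      ≤ ∫⁻ y in B, (∫⁻ t in Ioc (0 : ℝ) 1, g (x + t • (y - x)) * d) ∂μ := by
        refine setLIntegral_mono' hB fun y hy => ?_
        refine (enorm_sub_le_lintegral_fderiv hf x y).trans (lintegral_mono fun t => ?_)
        dsimp only
        gcongr
        exact hd y hy
    _ = ∫⁻ t in Ioc (0 : ℝ) 1, (∫⁻ y in B, g (x + t • (y - x)) * d ∂μ) := hswap
    _ ≤ ∫⁻ t in Ioc (0 : ℝ) 1, (μ B ^ (1 - 1 / q) * (∫⁻ y, g y ^ q ∂μ) ^ (1 / q) * d) *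
          ENNReal.ofReal ((t ^ finrank ℝ E)⁻¹) ^ (1 / q) := by
        refine setLIntegral_mono' measurableSet_Ioc fun t ht => ?_
        rw [lintegral_mul_const _ (by fun_prop)]
        exact (mul_le_mul_left (inner t ht) d).trans (le_of_eq (by ring))
    _ = _ := by
        rw [lintegral_const_mul _ (by fun_prop), morreyConst]; ring

end Morrey

/-! ### Convergence of mollifications -/

section Mollification

open scoped Convolution
open ContinuousLinearMap

variable {E F : Type*} [NormedAddCommGroup E] [NormedSpace ℝ E] [FiniteDimensional ℝ E]
  [MeasurableSpace E] [BorelSpace E] {μ : Measure E} [μ.IsAddHaarMeasure]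
  [NormedAddCommGroup F] [NormedSpace ℝ F] [CompleteSpace F]

/-- The translation action on `L^p`, `p < ∞`, is continuous; this expresses that continuity at zero
for representatives. -/
theorem tendsto_eLpNorm_translate_sub {F : Type*} [NormedAddCommGroup F] {p : ℝ≥0∞} (hp1 : 1 ≤ p) (hp : p ≠ ∞) {f : E → F}
    (hf : MemLp f p μ) :
    Tendsto (fun h => eLpNorm (fun x => f (x - h) - f x) p μ) (𝓝 0) (𝓝 0) := by
  have : Fact (1 ≤ p) := ⟨hp1⟩
  have : Fact (p ≠ ∞) := ⟨hp⟩
  have hc : Continuous fun h : E => DomAddAct.mk (-h) +ᵥ hf.toLp f := by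
    fun_prop
  have h0 := tendsto_iff_edist_tendsto_0.1 (hc.tendsto 0)
  refine h0.congr fun h => ?_
  rw [DomAddAct.mk_vadd_toLp, DomAddAct.mk_vadd_toLp, Lp.edist_toLp_toLp]
  congr 1
  ext x
  simp [sub_eq_neg_add]

/-- Mollifications converge in `L^p`. -/
theorem eLpNorm_mollify_sub_le {p : ℝ≥0∞} (hp1 : 1 ≤ p) (hp : p ≠ ∞) {f : E → F}
    (hfm : StronglyMeasurable f) (hf : MemLp f p μ) {ε : ℝ≥0∞} (hε : 0 < ε) :
    ∃ δ : ℝ, 0 < δ ∧ ∀ ρ : ContDiffBump (0 : E), ρ.rOut < δ →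
      eLpNorm (fun x => (ρ.normed μ ⋆[lsmul ℝ ℝ, μ] f) x - f x) p μ ≤ ε := by
  have htr := (tendsto_eLpNorm_translate_sub hp1 hp hf).eventually_le_const hε
  obtain ⟨δ, hδ, H⟩ := Metric.eventually_nhds_iff.1 htr
  refine ⟨δ, hδ, fun ρ hρ => ?_⟩
  have hp0 : p ≠ 0 := (one_pos.trans_le hp1).ne'
  have hq0 : 0 < p.toReal := ENNReal.toReal_pos hp0 hp
  set w : E → ℝ≥0∞ := fun h => ENNReal.ofReal (ρ.normed μ h) with hw
  have hρc : Continuous (ρ.normed μ) := (ρ.contDiff_normed (n := 0)).continuous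
  have hwm : Measurable w := hρc.measurable.ennreal_ofReal
  -- The kernel has mass one, so `ν` is a probability measure. Monotonicity of `L^p` norms over `ν`
  -- plays the role of Jensen's inequality, and Tonelli then leaves an average of translates by
  -- vectors in the kernel's support.
  set ν := μ.withDensity w with hν
  have hνuniv : ν univ = 1 := by
    rw [hν, withDensity_apply _ MeasurableSet.univ, Measure.restrict_univ, hw,
      ← ofReal_integral_eq_lintegral_ofReal ρ.integrable_normed
        (Eventually.of_forall fun h => ρ.nonneg_normed h), ρ.integral_normed]
    simp
  have : IsProbabilityMeasure ν := ⟨hνuniv⟩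
  have hloc : LocallyIntegrable f μ := hf.locallyIntegrable hp1
  have hcs : HasCompactSupport (ρ.normed μ) := ρ.hasCompactSupport_normed
  set D : E → E → F := fun x h => f (x - h) - f x with hD
  have hDm : StronglyMeasurable (Function.uncurry D) :=
    (hfm.comp_measurable (measurable_fst.sub measurable_snd)).sub (hfm.comp_measurable measurable_fst)
  have point : ∀ x, ‖(ρ.normed μ ⋆[lsmul ℝ ℝ, μ] f) x - f x‖ₑ ^ p.toReal ≤
      ∫⁻ h, ‖D x h‖ₑ ^ p.toReal ∂ν := by
    intro x
    have hint : Integrable (fun t => ρ.normed μ t • f (x - t)) μ :=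
      hcs.convolutionExists_left (lsmul ℝ ℝ) hρc hloc x
    have h1 : (ρ.normed μ ⋆[lsmul ℝ ℝ, μ] f) x - f x = ∫ t, ρ.normed μ t • D x t ∂μ := by
      simp only [hD, smul_sub]
      rw [integral_sub hint (ρ.integrable_normed.smul_const _), ρ.integral_normed_smul]
      rfl
    have h2 : ‖(ρ.normed μ ⋆[lsmul ℝ ℝ, μ] f) x - f x‖ₑ ≤ eLpNorm (D x) 1 ν := by
      rw [h1, eLpNorm_one_eq_lintegral_enorm]
      refine (enorm_integral_le_lintegral_enorm _).trans (le_of_eq ?_)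
      have hDx : Measurable fun t => ‖D x t‖ₑ :=
        (hDm.comp_measurable measurable_prodMk_left).enorm
      rw [hν, lintegral_withDensity_eq_lintegral_mul μ hwm hDx]
      refine lintegral_congr fun t => ?_
      rw [enorm_smul, Real.enorm_eq_ofReal (ρ.nonneg_normed t)]
      rfl
    have h3 : eLpNorm (D x) 1 ν ≤ eLpNorm (D x) p ν :=
      eLpNorm_le_eLpNorm_of_exponent_le hp1
        (hDm.comp_measurable measurable_prodMk_left).aestronglyMeasurable
    calc _ ≤ (eLpNorm (D x) p ν) ^ p.toReal := by gcongr; exact h2.trans h3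
      _ = _ := by
        rw [eLpNorm_eq_lintegral_rpow_enorm_toReal hp0 hp, ← ENNReal.rpow_mul,
          one_div_mul_cancel hq0.ne', ENNReal.rpow_one]
  rw [eLpNorm_eq_lintegral_rpow_enorm_toReal hp0 hp]
  rw [one_div, ENNReal.rpow_inv_le_iff hq0]
  calc ∫⁻ x, ‖(ρ.normed μ ⋆[lsmul ℝ ℝ, μ] f) x - f x‖ₑ ^ p.toReal ∂μ
      ≤ ∫⁻ x, (∫⁻ h, ‖D x h‖ₑ ^ p.toReal ∂ν) ∂μ := lintegral_mono point
    _ = ∫⁻ h, (∫⁻ x, ‖D x h‖ₑ ^ p.toReal ∂μ) ∂ν :=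
        lintegral_lintegral_swap (hDm.enorm.pow_const _).aemeasurable
    _ ≤ ∫⁻ h, ε ^ p.toReal ∂ν := by
        rw [hν, lintegral_withDensity_eq_lintegral_mul μ hwm
          (Measurable.lintegral_prod_left (hDm.enorm.pow_const _)),
          lintegral_withDensity_eq_lintegral_mul μ hwm measurable_const]
        refine lintegral_mono fun h => ?_
        by_cases hh : h ∈ Metric.ball (0 : E) ρ.rOut
        · simp only [Pi.mul_apply]
          gcongr
          have := H (y := h) ((Metric.mem_ball.1 hh).trans hρ)
          rw [eLpNorm_eq_lintegral_rpow_enorm_toReal hp0 hp, one_div,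
            ENNReal.rpow_inv_le_iff hq0] at this
          exact this
        · have : ρ.normed μ h = 0 := by
            rw [← ρ.support_normed_eq (μ := μ)] at hh
            simpa using hh
          simp [hw, this]
    _ = ε ^ p.toReal := by simp

end Mollification

/-! ### Approximation by test functions -/

section Density

open scoped Convolution
open ContinuousLinearMap

/-- The matrix of the derivative of a function `ℝ^N → ℝ^m`. -/
noncomputable def matGrad {m N : ℕ} (Φ : EuclideanSpace ℝ (Fin N) → EuclideanSpace ℝ (Fin m))
    (y : EuclideanSpace ℝ (Fin N)) : Mat m N :=
  WithLp.toLp 2 fun ij => fderiv ℝ Φ y (EuclideanSpace.single ij.2 1) ij.1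

/-- A Sobolev function with compact support in the cube is the limit of test functions. -/
theorem exists_testFunction_approx {m N : ℕ} {p : ℝ≥0∞} (hp1 : 1 ≤ p) (hp : p ≠ ∞)
    {v : EuclideanSpace ℝ (Fin N) → EuclideanSpace ℝ (Fin m)}
    {G : EuclideanSpace ℝ (Fin N) → Mat m N} (hvm : StronglyMeasurable v)
    (hGm : StronglyMeasurable G) (hv : MemLp v p volume) (hG : MemLp G p volume)
    {K : Set (EuclideanSpace ℝ (Fin N))} (hK : IsCompact K) (hKY : K ⊆ unitCube N)
    (hvK : ∀ y ∉ K, v y = 0)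
    (hvG : ∀ χ : EuclideanSpace ℝ (Fin N) → ℝ, ContDiff ℝ (⊤ : ℕ∞) χ → ∀ (i : Fin m) (j : Fin N),
      ∫ y, v y i * fderiv ℝ χ y (EuclideanSpace.single j 1) = -∫ y, G y (i, j) * χ y)
    {ε : ℝ≥0∞} (hε : 0 < ε) :
    ∃ Φ : EuclideanSpace ℝ (Fin N) → EuclideanSpace ℝ (Fin m), IsTestFunction N Φ ∧
      eLpNorm (fun y => Φ y - v y) p volume ≤ ε ∧
      eLpNorm (fun y => matGrad Φ y - G y) p volume ≤ ε := by
  obtain ⟨δ₁, hδ₁, H₁⟩ := eLpNorm_mollify_sub_le hp1 hp hvm hv hε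
  obtain ⟨δ₂, hδ₂, H₂⟩ := eLpNorm_mollify_sub_le hp1 hp hGm hG hε
  obtain ⟨δ₃, hδ₃, H₃⟩ := hK.exists_cthickening_subset_open (isOpen_unitCube N) hKY
  -- `δ₁` and `δ₂` control the approximation of `v` and `G`; `δ₃` keeps the support of the mollified
  -- function in the cube.
  set r : ℝ := min (min δ₁ δ₂) δ₃ / 2 with hr
  have hr0 : 0 < r := by positivity
  have hrlt : r < min (min δ₁ δ₂) δ₃ := half_lt_self (by positivity)
  let ρ : ContDiffBump (0 : EuclideanSpace ℝ (Fin N)) := ⟨r / 2, r, by positivity, by linarith⟩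
  have hρ1 : ρ.rOut < δ₁ := hrlt.trans_le ((min_le_left _ _).trans (min_le_left _ _))
  have hρ2 : ρ.rOut < δ₂ := hrlt.trans_le ((min_le_left _ _).trans (min_le_right _ _))
  have hρ3 : ρ.rOut < δ₃ := hrlt.trans_le (min_le_right _ _)
  set η : EuclideanSpace ℝ (Fin N) → ℝ := ρ.normed volume with hη
  have hηs : ContDiff ℝ (⊤ : ℕ∞) η := ρ.contDiff_normed
  have hηcs : HasCompactSupport η := ρ.hasCompactSupport_normed
  have hvl : LocallyIntegrable v volume := hv.locallyIntegrable hp1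
  have hGl : LocallyIntegrable G volume := hG.locallyIntegrable hp1
  set Φ := v ⋆[(lsmul ℝ ℝ).flip, volume] η with hΦ
  have hΦs : ContDiff ℝ (⊤ : ℕ∞) Φ := hηcs.contDiff_convolution_right _ hvl hηs
  have hsupp : tsupport Φ ⊆ Metric.cthickening δ₃ K := by
    refine closure_minimal ?_ Metric.isClosed_cthickening
    refine (support_convolution_subset _).trans ?_
    rintro _ ⟨a, ha, b, hb, rfl⟩
    have haK : a ∈ K := by
      by_contra h
      exact ha (hvK a h)
    rw [hη, ρ.support_normed_eq] at hb
    refine Metric.mem_cthickening_of_dist_le _ a _ _ haK ?_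
    have : ‖b‖ < ρ.rOut := by simpa using hb
    simpa using (this.trans hρ3).le
  have hΦcs : HasCompactSupport Φ :=
    hK.cthickening.of_isClosed_subset (isClosed_tsupport _) hsupp
  -- Differentiation falls on the kernel, and the weak-gradient identity moves it to `v`. The
  -- function used there, `y ↦ η (x - y)`, need not be supported in the cube, which is why `hvG`
  -- ranges over all smooth `χ`.
  have hgrad : ∀ x, matGrad Φ x = (η ⋆[lsmul ℝ ℝ, volume] G) x := by
    intro x
    ext ⟨i, j⟩
    have hη1 : ContDiff ℝ 1 η := hηs.of_le (by simp)
    set e : EuclideanSpace ℝ (Fin N) := EuclideanSpace.single j 1 with he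
    have h1 : fderiv ℝ Φ x e = ∫ t, fderiv ℝ η (x - t) e • v t := by
      rw [(hηcs.hasFDerivAt_convolution_right (lsmul ℝ ℝ).flip hvl hη1 x).fderiv,
        convolution_precompR_apply _ hvl (hηcs.fderiv ℝ) (hη1.continuous_fderiv one_ne_zero)]
      rfl
    have hi1 : Integrable (fun t => fderiv ℝ η (x - t) e • v t) :=
      (hηcs.fderiv_apply ℝ e).convolutionExists_right (lsmul ℝ ℝ).flip hvl
        ((hη1.continuous_fderiv one_ne_zero).clm_apply continuous_const) x
    have hi2 : Integrable (fun t => η t • G (x - t)) :=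
      hηcs.convolutionExists_left (lsmul ℝ ℝ) hηs.continuous hGl x
    have h2 : matGrad Φ x (i, j) = ∫ t, fderiv ℝ η (x - t) e * v t i := by
      change (fderiv ℝ Φ x e) i = _
      rw [h1]
      exact ((EuclideanSpace.proj (𝕜 := ℝ) i).integral_comp_comm hi1).symm
    have h3 : (η ⋆[lsmul ℝ ℝ, volume] G) x (i, j) = ∫ t, η (x - t) * G t (i, j) := by
      have e1 : (η ⋆[lsmul ℝ ℝ, volume] G) x (i, j) = ∫ t, η t * G (x - t) (i, j) :=
        ((EuclideanSpace.proj (𝕜 := ℝ) (i, j)).integral_comp_comm hi2).symm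
      rw [e1, ← integral_sub_left_eq_self _ volume x]
      simp
    have hχ := hvG (fun y => η (x - y)) (hηs.comp (contDiff_const.sub contDiff_id)) i j
    have hdχ : ∀ y, fderiv ℝ (fun y => η (x - y)) y e = -fderiv ℝ η (x - y) e := by
      intro y
      have hd : HasFDerivAt (fun y => η (x - y)) ((fderiv ℝ η (x - y)).comp
          (-ContinuousLinearMap.id ℝ _)) y :=
        ((hη1.differentiable one_ne_zero) (x - y)).hasFDerivAt.comp y
          ((hasFDerivAt_id y).const_sub x)
      rw [hd.fderiv]; simp
    rw [h2, h3]
    simp only [← he, hdχ, mul_neg, integral_neg, neg_inj] at hχ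
    simpa only [mul_comm] using hχ
  refine ⟨Φ, ⟨hΦs, hΦcs, hsupp.trans H₃⟩, ?_, ?_⟩
  · have := H₁ ρ hρ1
    rwa [← convolution_flip] at this
  · simp only [hgrad]
    exact H₂ ρ hρ2

end Density

/-! ### Matrix gradients, tensor products and test functions -/

section Gradients

variable {m N : ℕ}

/-- The matrix `a ⊗ D`. -/
noncomputable def tensor (a : EuclideanSpace ℝ (Fin m)) (D : EuclideanSpace ℝ (Fin N) →L[ℝ] ℝ) :
    Mat m N :=
  WithLp.toLp 2 fun ij => a ij.1 * D (EuclideanSpace.single ij.2 1)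

@[simp]
theorem tensor_apply (a : EuclideanSpace ℝ (Fin m)) (D : EuclideanSpace ℝ (Fin N) →L[ℝ] ℝ)
    (i : Fin m) (j : Fin N) : tensor a D (i, j) = a i * D (EuclideanSpace.single j 1) := rfl

@[simp]
theorem tensor_zero (a : EuclideanSpace ℝ (Fin m)) :
    tensor a (0 : EuclideanSpace ℝ (Fin N) →L[ℝ] ℝ) = 0 := by
  ext ⟨i, j⟩; simp

@[simp]
theorem matGrad_apply (Φ : EuclideanSpace ℝ (Fin N) → EuclideanSpace ℝ (Fin m))
    (y : EuclideanSpace ℝ (Fin N)) (i : Fin m) (j : Fin N) :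
    matGrad Φ y (i, j) = fderiv ℝ Φ y (EuclideanSpace.single j 1) i := rfl

/-- Each of the `N` columns has norm at most `‖a‖ * ‖D‖`; the factor `√N` is not sharp, but any
constant would do. -/
theorem norm_tensor_le (a : EuclideanSpace ℝ (Fin m)) (D : EuclideanSpace ℝ (Fin N) →L[ℝ] ℝ) :
    ‖tensor a D‖ ≤ √N * ‖a‖ * ‖D‖ := by
  rw [EuclideanSpace.norm_eq]
  refine Real.sqrt_le_iff.2 ⟨by positivity, ?_⟩
  have h1 : ∀ ij : Fin m × Fin N, ‖tensor a D ij‖ ^ 2 ≤ ‖a ij.1‖ ^ 2 * ‖D‖ ^ 2 := by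
    rintro ⟨i, j⟩
    rw [tensor_apply, norm_mul, mul_pow]
    have : ‖D (EuclideanSpace.single j 1)‖ ≤ ‖D‖ := by
      simpa using D.le_opNorm (EuclideanSpace.single j 1)
    gcongr
  calc ∑ ij, ‖tensor a D ij‖ ^ 2 ≤ ∑ ij : Fin m × Fin N, ‖a ij.1‖ ^ 2 * ‖D‖ ^ 2 :=
        Finset.sum_le_sum fun ij _ => h1 ij
    _ = N * ((∑ i, ‖a i‖ ^ 2) * ‖D‖ ^ 2) := by
        rw [Fintype.sum_prod_type, Finset.sum_mul, Finset.mul_sum]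
        simp
    _ = (√N * ‖a‖ * ‖D‖) ^ 2 := by
        rw [← EuclideanSpace.norm_sq_eq, mul_pow, mul_pow, Real.sq_sqrt (Nat.cast_nonneg N)]
        ring

theorem continuous_tensor : Continuous fun x : EuclideanSpace ℝ (Fin m) ×
    (EuclideanSpace ℝ (Fin N) →L[ℝ] ℝ) => tensor x.1 x.2 :=
  (PiLp.continuous_toLp 2 _).comp (by fun_prop)

/-- Cauchy–Schwarz in each row. It passes from the operator norm in Morrey's inequality to the
Euclidean norm on matrices. -/
theorem norm_fderiv_le_norm_matGrad (Φ : EuclideanSpace ℝ (Fin N) → EuclideanSpace ℝ (Fin m))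
    (y : EuclideanSpace ℝ (Fin N)) : ‖fderiv ℝ Φ y‖ ≤ ‖matGrad Φ y‖ := by
  refine ContinuousLinearMap.opNorm_le_bound _ (norm_nonneg _) fun h => ?_
  set G := matGrad Φ y with hG
  have hcoord : ∀ i, fderiv ℝ Φ y h i = ∑ j, h j * G (i, j) := by
    intro i
    have hh : h = ∑ j, h j • EuclideanSpace.single j (1 : ℝ) := by
      ext k; simp [Pi.single_apply]
    conv_lhs => rw [hh, map_sum]
    simp [hG]
  rw [EuclideanSpace.norm_eq]
  refine Real.sqrt_le_iff.2 ⟨by positivity, ?_⟩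
  calc ∑ i, ‖fderiv ℝ Φ y h i‖ ^ 2 ≤ ∑ i, (∑ j, h j ^ 2) * ∑ j, G (i, j) ^ 2 := by
        refine Finset.sum_le_sum fun i _ => ?_
        rw [hcoord, Real.norm_eq_abs, sq_abs]
        exact Finset.sum_mul_sq_le_sq_mul_sq _ _ _
    _ = (‖G‖ * ‖h‖) ^ 2 := by
        rw [← Finset.mul_sum, mul_pow, EuclideanSpace.norm_sq_eq, EuclideanSpace.norm_sq_eq,
          Fintype.sum_prod_type, mul_comm]
        simp

theorem continuous_matGrad {Φ : EuclideanSpace ℝ (Fin N) → EuclideanSpace ℝ (Fin m)}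
    (hΦ : ContDiff ℝ 1 Φ) : Continuous (matGrad Φ) := by
  have := hΦ.continuous_fderiv one_ne_zero
  exact (PiLp.continuous_toLp 2 _).comp (by fun_prop)

theorem IsTestFunction.eq_zero_of_notMem {F : Type*} [NormedAddCommGroup F] [NormedSpace ℝ F]
    {φ : EuclideanSpace ℝ (Fin N) → F} (hφ : IsTestFunction N φ) {y : EuclideanSpace ℝ (Fin N)}
    (hy : y ∉ unitCube N) : φ y = 0 :=
  image_eq_zero_of_notMem_tsupport fun h => hy (hφ.2.2 h)

theorem IsTestFunction.fderiv_eq_zero_of_notMem {F : Type*} [NormedAddCommGroup F]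
    [NormedSpace ℝ F] {φ : EuclideanSpace ℝ (Fin N) → F} (hφ : IsTestFunction N φ)
    {y : EuclideanSpace ℝ (Fin N)} (hy : y ∉ unitCube N) : fderiv ℝ φ y = 0 :=
  image_eq_zero_of_notMem_tsupport fun h => hy (hφ.2.2 (tsupport_fderiv_subset ℝ h))

theorem IsTestFunction.mul_contDiff {φ χ : EuclideanSpace ℝ (Fin N) → ℝ}
    (hφ : IsTestFunction N φ) (hχ : ContDiff ℝ (⊤ : ℕ∞) χ) : IsTestFunction N (fun y => φ y * χ y) :=
  ⟨hφ.1.mul hχ, hφ.2.1.mul_right, (tsupport_mul_subset_left).trans hφ.2.2⟩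

theorem IsTestFunction.continuous_fderiv {F : Type*} [NormedAddCommGroup F]
    [NormedSpace ℝ F] {φ : EuclideanSpace ℝ (Fin N) → F} (hφ : IsTestFunction N φ) :
    Continuous (fderiv ℝ φ) := hφ.1.continuous_fderiv (by simp)

theorem IsTestFunction.exists_norm_fderiv_le {F : Type*} [NormedAddCommGroup F]
    [NormedSpace ℝ F] {φ : EuclideanSpace ℝ (Fin N) → F} (hφ : IsTestFunction N φ) :
    ∃ C : ℝ, 0 ≤ C ∧ ∀ y, ‖fderiv ℝ φ y‖ ≤ C := by
  obtain ⟨C, hC⟩ := (hφ.2.1.fderiv ℝ).exists_bound_of_continuous hφ.continuous_fderiv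
  exact ⟨C, (norm_nonneg _).trans (hC 0), hC⟩

theorem IsTestFunction.exists_norm_le {F : Type*} [NormedAddCommGroup F]
    [NormedSpace ℝ F] {φ : EuclideanSpace ℝ (Fin N) → F} (hφ : IsTestFunction N φ) :
    ∃ C : ℝ, 0 ≤ C ∧ ∀ y, ‖φ y‖ ≤ C := by
  obtain ⟨C, hC⟩ := hφ.2.1.exists_bound_of_continuous hφ.1.continuous
  exact ⟨C, (norm_nonneg _).trans (hC 0), hC⟩

theorem IsTestFunction.isWeakGradient {Φ : EuclideanSpace ℝ (Fin N) → EuclideanSpace ℝ (Fin m)}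
    (hΦ : IsTestFunction N Φ) : IsWeakGradient m N Φ (matGrad Φ) := by
  intro φ hφ i j
  set e : EuclideanSpace ℝ (Fin N) := EuclideanSpace.single j 1 with he
  set f : EuclideanSpace ℝ (Fin N) → ℝ := fun y => Φ y i with hf
  have hd : ∀ y, HasFDerivAt f ((EuclideanSpace.proj (𝕜 := ℝ) i).comp (fderiv ℝ Φ y)) y := fun y =>
    (EuclideanSpace.proj (𝕜 := ℝ) i).hasFDerivAt.comp y
      ((hΦ.1.differentiable (by simp)) y).hasFDerivAt
  have hfd : ∀ y, fderiv ℝ f y e = matGrad Φ y (i, j) := fun y => by rw [(hd y).fderiv]; rfl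
  have hfc : Continuous f := (EuclideanSpace.proj (𝕜 := ℝ) i).continuous.comp hΦ.1.continuous
  have hgc : Continuous fun y => matGrad Φ y (i, j) :=
    (EuclideanSpace.proj (𝕜 := ℝ) (i, j)).continuous.comp
      (continuous_matGrad (hΦ.1.of_le (by simp)))
  have hc := hφ.continuous_partial e
  have key := integral_mul_fderiv_eq_neg_fderiv_mul_of_integrable (μ := volume) (𝕜 := ℝ) (v := e)
    (f := f) (g := φ)
    (by simp only [hfd]
        exact (hgc.mul hφ.1.continuous).integrable_of_hasCompactSupport hφ.2.1.mul_left)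
    ((hfc.mul hc).integrable_of_hasCompactSupport (hφ.2.1.fderiv_apply ℝ e).mul_left)
    ((hfc.mul hφ.1.continuous).integrable_of_hasCompactSupport hφ.2.1.mul_left)
    (fun y _ => (hd y).differentiableAt) (fun y _ => hφ.1.differentiable (by simp) y)
  simp only [hfd] at key
  rw [cubeMeasure,
    setIntegral_eq_integral_of_forall_compl_eq_zero (fun y hy => by
      rw [hφ.fderiv_eq_zero_of_notMem hy]; simp),
    setIntegral_eq_integral_of_forall_compl_eq_zero (fun y hy => by
      rw [hφ.eq_zero_of_notMem hy]; simp)]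
  exact key

theorem IsTestFunction.memLp_matGrad {p : ℝ≥0∞}
    {Φ : EuclideanSpace ℝ (Fin N) → EuclideanSpace ℝ (Fin m)}
    (hΦ : IsTestFunction N Φ) : MemLp (matGrad Φ) p (cubeMeasure N) :=
  memLp_of_continuous N (continuous_matGrad (hΦ.1.of_le (by simp))) p

end Gradients

/-! ### Sobolev functions, cut-offs and `W^{1,p}_0` -/

section Sobolev

variable {m N : ℕ} {p : ℝ≥0∞} [hp1 : Fact (1 ≤ p)]

theorem W1p.isWeakGradient (u : W1p m N p) : IsWeakGradient m N (W1p.val u) (W1p.grad u) := u.2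

theorem W1p.memLp_val (u : W1p m N p) : MemLp (W1p.val u) p (cubeMeasure N) := Lp.memLp u.1.1

theorem W1p.memLp_grad (u : W1p m N p) : MemLp (W1p.grad u) p (cubeMeasure N) := Lp.memLp u.1.2

/-- The element of `W^{1,p}` with given value and gradient. -/
noncomputable def W1p.mk {v : EuclideanSpace ℝ (Fin N) → EuclideanSpace ℝ (Fin m)}
    {G : EuclideanSpace ℝ (Fin N) → Mat m N} (hv : MemLp v p (cubeMeasure N))
    (hG : MemLp G p (cubeMeasure N)) (h : IsWeakGradient m N v G) : W1p m N p :=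
  ⟨(hv.toLp v, hG.toLp G), by
    intro φ hφ i j
    refine (integral_congr_ae ?_).trans ((h φ hφ i j).trans
      (congrArg Neg.neg (integral_congr_ae ?_)))
    · filter_upwards [hv.coeFn_toLp] with y hy
      simp only [hy]
    · filter_upwards [hG.coeFn_toLp] with y hy
      simp only [hy]⟩

theorem W1p.val_mk {v : EuclideanSpace ℝ (Fin N) → EuclideanSpace ℝ (Fin m)}
    {G : EuclideanSpace ℝ (Fin N) → Mat m N} (hv : MemLp v p (cubeMeasure N))
    (hG : MemLp G p (cubeMeasure N)) (h : IsWeakGradient m N v G) :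
    W1p.val (W1p.mk hv hG h) =ᵐ[cubeMeasure N] v := hv.coeFn_toLp

theorem W1p.grad_mk {v : EuclideanSpace ℝ (Fin N) → EuclideanSpace ℝ (Fin m)}
    {G : EuclideanSpace ℝ (Fin N) → Mat m N} (hv : MemLp v p (cubeMeasure N))
    (hG : MemLp G p (cubeMeasure N)) (h : IsWeakGradient m N v G) :
    W1p.grad (W1p.mk hv hG h) =ᵐ[cubeMeasure N] G := hG.coeFn_toLp

theorem W1p.val_add (u w : W1p m N p) :
    W1p.val (u + w) =ᵐ[cubeMeasure N] fun y => W1p.val u y + W1p.val w y := Lp.coeFn_add _ _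

theorem W1p.grad_add (u w : W1p m N p) :
    W1p.grad (u + w) =ᵐ[cubeMeasure N] fun y => W1p.grad u y + W1p.grad w y := Lp.coeFn_add _ _

theorem W1p.grad_sub (u w : W1p m N p) :
    W1p.grad (u - w) =ᵐ[cubeMeasure N] fun y => W1p.grad u y - W1p.grad w y := Lp.coeFn_sub _ _

theorem W1p.val_smul (c : ℝ) (u : W1p m N p) :
    W1p.val (c • u) =ᵐ[cubeMeasure N] fun y => c • W1p.val u y := Lp.coeFn_smul _ _

theorem W1p.grad_smul (c : ℝ) (u : W1p m N p) :
    W1p.grad (c • u) =ᵐ[cubeMeasure N] fun y => c • W1p.grad u y := Lp.coeFn_smul _ _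

theorem W1p.grad_linW (ξ : Mat m N) :
    W1p.grad (linW m N p ξ) =ᵐ[cubeMeasure N] fun _ => ξ :=
  (memLp_of_continuous N continuous_const p).coeFn_toLp

/-- A test function as an element of `W^{1,p}`. -/
noncomputable def IsTestFunction.toW1p
    {Φ : EuclideanSpace ℝ (Fin N) → EuclideanSpace ℝ (Fin m)} (hΦ : IsTestFunction N Φ) :
    W1p m N p :=
  W1p.mk (memLp_of_continuous N hΦ.1.continuous p) hΦ.memLp_matGrad hΦ.isWeakGradient

theorem IsTestFunction.grad_toW1p
    {Φ : EuclideanSpace ℝ (Fin N) → EuclideanSpace ℝ (Fin m)} (hΦ : IsTestFunction N Φ) :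
    W1p.grad (hΦ.toW1p (p := p)) =ᵐ[cubeMeasure N] matGrad Φ := W1p.grad_mk _ _ _

theorem IsTestFunction.toW1p_mem_set
    {Φ : EuclideanSpace ℝ (Fin N) → EuclideanSpace ℝ (Fin m)} (hΦ : IsTestFunction N Φ) :
    hΦ.toW1p (p := p) ∈ {u : W1p m N p | ∃ φ : EuclideanSpace ℝ (Fin N) → EuclideanSpace ℝ (Fin m),
      IsTestFunction N φ ∧ W1p.val u =ᵐ[cubeMeasure N] φ} :=
  ⟨Φ, hΦ, W1p.val_mk _ _ _⟩

theorem IsTestFunction.add {F : Type*} [NormedAddCommGroup F] [NormedSpace ℝ F]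
    {φ χ : EuclideanSpace ℝ (Fin N) → F} (hφ : IsTestFunction N φ) (hχ : IsTestFunction N χ) :
    IsTestFunction N (fun y => φ y + χ y) :=
  ⟨hφ.1.add hχ.1, hφ.2.1.add hχ.2.1, (tsupport_add φ χ).trans (union_subset hφ.2.2 hχ.2.2)⟩

theorem IsTestFunction.const_smul {F : Type*} [NormedAddCommGroup F] [NormedSpace ℝ F]
    {φ : EuclideanSpace ℝ (Fin N) → F} (hφ : IsTestFunction N φ) (c : ℝ) :
    IsTestFunction N (fun y => c • φ y) :=
  have h : tsupport (fun y => c • φ y) ⊆ tsupport φ :=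
    tsupport_smul_subset_right (fun _ => c) φ
  ⟨hφ.1.const_smul c, hφ.2.1.of_isClosed_subset (isClosed_tsupport _) h, h.trans hφ.2.2⟩

theorem W1p0_add {u w : W1p m N p} (hu : u ∈ W1p0 m N p) (hw : w ∈ W1p0 m N p) :
    u + w ∈ W1p0 m N p := by
  refine map_mem_closure₂ continuous_add hu hw ?_
  rintro a ⟨φ, hφ, ha⟩ b ⟨χ, hχ, hb⟩
  refine ⟨_, hφ.add hχ, ?_⟩
  filter_upwards [W1p.val_add a b, ha, hb] with y h h1 h2
  rw [h, h1, h2]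

theorem W1p0_smul (c : ℝ) {u : W1p m N p} (hu : u ∈ W1p0 m N p) : c • u ∈ W1p0 m N p := by
  refine map_mem_closure (continuous_const_smul c) hu ?_
  rintro a ⟨φ, hφ, ha⟩
  refine ⟨_, hφ.const_smul c, ?_⟩
  filter_upwards [W1p.val_smul c a, ha] with y h h1
  rw [h, h1]

theorem IsTestFunction.toW1p_mem
    {Φ : EuclideanSpace ℝ (Fin N) → EuclideanSpace ℝ (Fin m)} (hΦ : IsTestFunction N Φ) :
    hΦ.toW1p (p := p) ∈ W1p0 m N p := subset_closure hΦ.toW1p_mem_set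

/-- The gradient of `ψ u`. -/
noncomputable def cutoffGrad (ψ : EuclideanSpace ℝ (Fin N) → ℝ) (u : W1p m N p)
    (y : EuclideanSpace ℝ (Fin N)) : Mat m N :=
  ψ y • W1p.grad u y + tensor (W1p.val u y) (fderiv ℝ ψ y)

theorem IsTestFunction.stronglyMeasurable_cutoffGrad {ψ : EuclideanSpace ℝ (Fin N) → ℝ}
    (hψ : IsTestFunction N ψ) (u : W1p m N p) : StronglyMeasurable (cutoffGrad ψ u) := by
  refine (hψ.1.continuous.stronglyMeasurable.smul (Lp.stronglyMeasurable _)).add ?_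
  exact continuous_tensor.comp_stronglyMeasurable
    ((Lp.stronglyMeasurable u.1.1).prodMk hψ.continuous_fderiv.stronglyMeasurable)

/-- The constant depends only on the sup norms of `ψ` and its derivative, so norm-bounded sequences
keep uniformly bounded gradients after cut-off. -/
theorem IsTestFunction.exists_eLpNorm_cutoffGrad_le {ψ : EuclideanSpace ℝ (Fin N) → ℝ}
    (hψ : IsTestFunction N ψ) : ∃ C : ℝ≥0, ∀ u : W1p m N p,
      eLpNorm (cutoffGrad ψ u) p (cubeMeasure N) ≤ C * ENNReal.ofReal ‖u‖ := by
  obtain ⟨C₁, h₁, H₁⟩ := hψ.exists_norm_le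
  obtain ⟨C₂, h₂, H₂⟩ := hψ.exists_norm_fderiv_le
  refine ⟨Real.toNNReal (C₁ + √N * C₂), fun u => ?_⟩
  have hval : eLpNorm (W1p.val u) p (cubeMeasure N) ≤ ENNReal.ofReal ‖u‖ := by
    rw [← ENNReal.ofReal_toReal (W1p.memLp_val u).eLpNorm_ne_top]
    exact ENNReal.ofReal_le_ofReal (norm_fst_le u.1)
  have hgrad : eLpNorm (W1p.grad u) p (cubeMeasure N) ≤ ENNReal.ofReal ‖u‖ := by
    rw [← ENNReal.ofReal_toReal (W1p.memLp_grad u).eLpNorm_ne_top]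
    exact ENNReal.ofReal_le_ofReal (norm_snd_le u.1)
  have m1 : AEStronglyMeasurable (fun y => ψ y • W1p.grad u y) (cubeMeasure N) :=
    (hψ.1.continuous.stronglyMeasurable.smul (Lp.stronglyMeasurable _)).aestronglyMeasurable
  have m2 : AEStronglyMeasurable (fun y => tensor (W1p.val u y) (fderiv ℝ ψ y)) (cubeMeasure N) :=
    (continuous_tensor.comp_stronglyMeasurable
      ((Lp.stronglyMeasurable u.1.1).prodMk
        hψ.continuous_fderiv.stronglyMeasurable)).aestronglyMeasurable
  have b1 : eLpNorm (fun y => ψ y • W1p.grad u y) p (cubeMeasure N) ≤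
      ENNReal.ofReal C₁ * eLpNorm (W1p.grad u) p (cubeMeasure N) := by
    refine eLpNorm_le_mul_eLpNorm_of_ae_le_mul (Eventually.of_forall fun y => ?_) p
    rw [norm_smul]
    gcongr
    exact H₁ y
  have b2 : eLpNorm (fun y => tensor (W1p.val u y) (fderiv ℝ ψ y)) p (cubeMeasure N) ≤
      ENNReal.ofReal (√N * C₂) * eLpNorm (W1p.val u) p (cubeMeasure N) := by
    refine eLpNorm_le_mul_eLpNorm_of_ae_le_mul (Eventually.of_forall fun y => ?_) p
    refine (norm_tensor_le _ _).trans ?_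
    calc √N * ‖W1p.val u y‖ * ‖fderiv ℝ ψ y‖ ≤ √N * ‖W1p.val u y‖ * C₂ := by gcongr; exact H₂ y
      _ = _ := by ring
  calc eLpNorm (cutoffGrad ψ u) p (cubeMeasure N) ≤ _ + _ := eLpNorm_add_le m1 m2 hp1.out
    _ ≤ ENNReal.ofReal C₁ * ENNReal.ofReal ‖u‖ + ENNReal.ofReal (√N * C₂) * ENNReal.ofReal ‖u‖ := by
        gcongr
        · exact b1.trans (by gcongr)
        · exact b2.trans (by gcongr)
    _ = _ := by
        rw [← add_mul, ← ENNReal.ofReal_add h₁ (by positivity)]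
        rfl

theorem IsTestFunction.memLp_cutoffGrad {ψ : EuclideanSpace ℝ (Fin N) → ℝ}
    (hψ : IsTestFunction N ψ) (u : W1p m N p) : MemLp (cutoffGrad ψ u) p (cubeMeasure N) := by
  obtain ⟨C, hC⟩ := hψ.exists_eLpNorm_cutoffGrad_le (m := m) (p := p)
  exact ⟨(hψ.stronglyMeasurable_cutoffGrad u).aestronglyMeasurable, (hC u).trans_lt
    (ENNReal.mul_lt_top ENNReal.coe_lt_top ENNReal.ofReal_lt_top)⟩

theorem IsTestFunction.memLp_smul_val {ψ : EuclideanSpace ℝ (Fin N) → ℝ}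
    (hψ : IsTestFunction N ψ) (u : W1p m N p) :
    MemLp (fun y => ψ y • W1p.val u y) p (cubeMeasure N) :=
  (W1p.memLp_val u).smul (memLp_of_continuous N hψ.1.continuous ∞)

/-- Test the weak gradient of `u` with `ψ χ`. The compact support of `ψ` suffices, so `χ` may be any
smooth function, in particular a translated mollifier. -/
theorem IsTestFunction.integral_smul_val_mul_fderiv {ψ : EuclideanSpace ℝ (Fin N) → ℝ}
    (hψ : IsTestFunction N ψ) (u : W1p m N p) {χ : EuclideanSpace ℝ (Fin N) → ℝ}
    (hχ : ContDiff ℝ (⊤ : ℕ∞) χ) (i : Fin m) (j : Fin N) :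
    ∫ y, (ψ y • W1p.val u y) i * fderiv ℝ χ y (EuclideanSpace.single j 1) ∂cubeMeasure N
      = -∫ y, cutoffGrad ψ u y (i, j) * χ y ∂cubeMeasure N := by
  set e : EuclideanSpace ℝ (Fin N) := EuclideanSpace.single j 1 with he
  have key := W1p.isWeakGradient u _ (hψ.mul_contDiff hχ) i j
  have hd : ∀ y, fderiv ℝ (fun y => ψ y * χ y) y e = ψ y * fderiv ℝ χ y e + χ y * fderiv ℝ ψ y e := by
    intro y
    rw [fderiv_fun_mul (hψ.1.differentiable (by simp) y) (hχ.differentiable (by simp) y)]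
    simp
  have hχ' : Continuous fun y => fderiv ℝ χ y e :=
    (hχ.continuous_fderiv (by simp)).clm_apply continuous_const
  have hψ' := hψ.continuous_partial e
  have iv : Integrable (fun y => W1p.val u y i) (cubeMeasure N) := integrable_coord u.1.1 i
  have ig : Integrable (fun y => W1p.grad u y (i, j)) (cubeMeasure N) := integrable_entry u.1.2 i j
  have i1 : Integrable (fun y => W1p.val u y i * (ψ y * fderiv ℝ χ y e)) (cubeMeasure N) :=
    integrable_mul_of_continuous N iv (hψ.1.continuous.mul hχ')
  have i2 : Integrable (fun y => W1p.val u y i * (χ y * fderiv ℝ ψ y e)) (cubeMeasure N) :=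
    integrable_mul_of_continuous N iv (hχ.continuous.mul hψ')
  have i3 : Integrable (fun y => W1p.grad u y (i, j) * (ψ y * χ y)) (cubeMeasure N) :=
    integrable_mul_of_continuous N ig (hψ.1.continuous.mul hχ.continuous)
  simp only [← he, hd, mul_add] at key
  rw [integral_add i1 i2] at key
  have e1 : ∀ y, (ψ y • W1p.val u y) i * fderiv ℝ χ y e = W1p.val u y i * (ψ y * fderiv ℝ χ y e) :=
    fun y => by simp only [PiLp.smul_apply, smul_eq_mul]; ring
  have e2 : ∀ y, cutoffGrad ψ u y (i, j) * χ y =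
      W1p.grad u y (i, j) * (ψ y * χ y) + W1p.val u y i * (χ y * fderiv ℝ ψ y e) := fun y => by
    simp only [cutoffGrad, PiLp.add_apply, PiLp.smul_apply, smul_eq_mul, tensor_apply, he]; ring
  simp only [e1, e2]
  rw [integral_add i3 i2]
  linarith

/-- The product of a Sobolev function and a cut-off function. -/
noncomputable def IsTestFunction.cutoff {ψ : EuclideanSpace ℝ (Fin N) → ℝ}
    (hψ : IsTestFunction N ψ) (u : W1p m N p) : W1p m N p :=
  W1p.mk (hψ.memLp_smul_val u) (hψ.memLp_cutoffGrad u)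
    fun _ hχ i j => hψ.integral_smul_val_mul_fderiv u hχ.1 i j

/-- Since `ψ u` vanishes near the boundary, its extension by zero is Sobolev on the whole space and
can be mollified. -/
theorem IsTestFunction.exists_approx_cutoff {ψ : EuclideanSpace ℝ (Fin N) → ℝ}
    (hψ : IsTestFunction N ψ) (hp : p ≠ ∞) (u : W1p m N p) {ε : ℝ≥0∞} (hε : 0 < ε) :
    ∃ Φ : EuclideanSpace ℝ (Fin N) → EuclideanSpace ℝ (Fin m), IsTestFunction N Φ ∧
      eLpNorm (fun y => Φ y - ψ y • W1p.val u y) p (cubeMeasure N) ≤ ε ∧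
      eLpNorm (fun y => matGrad Φ y - cutoffGrad ψ u y) p (cubeMeasure N) ≤ ε := by
  have hY := (isOpen_unitCube N).measurableSet
  have z1 : ∀ y ∉ tsupport ψ, ψ y • W1p.val u y = 0 := fun y hy => by
    rw [image_eq_zero_of_notMem_tsupport hy, zero_smul]
  have z2 : ∀ y ∉ unitCube N, cutoffGrad ψ u y = 0 := fun y hy => by
    simp [cutoffGrad, hψ.eq_zero_of_notMem hy, hψ.fderiv_eq_zero_of_notMem hy]
  have z1' : ∀ y ∉ unitCube N, ψ y • W1p.val u y = 0 := fun y hy => z1 y fun h => hy (hψ.2.2 h)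
  have hv : MemLp (fun y => ψ y • W1p.val u y) p volume := by
    have := (memLp_indicator_iff_restrict hY).2 (hψ.memLp_smul_val u)
    rwa [indicator_eq_self.2 (Function.support_subset_iff'.2 z1')] at this
  have hG : MemLp (cutoffGrad ψ u) p volume := by
    have := (memLp_indicator_iff_restrict hY).2 (hψ.memLp_cutoffGrad u)
    rwa [indicator_eq_self.2 (Function.support_subset_iff'.2 z2)] at this
  obtain ⟨Φ, hΦ, h1, h2⟩ := exists_testFunction_approx hp1.out hp
    (hψ.1.continuous.stronglyMeasurable.smul (Lp.stronglyMeasurable _))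
    (hψ.stronglyMeasurable_cutoffGrad u) hv hG hψ.2.1 hψ.2.2 z1 (fun χ hχ i j => by
      have := hψ.integral_smul_val_mul_fderiv u hχ i j
      rwa [cubeMeasure,
        setIntegral_eq_integral_of_forall_compl_eq_zero (fun y hy => by rw [z1' y hy]; simp),
        setIntegral_eq_integral_of_forall_compl_eq_zero (fun y hy => by rw [z2 y hy]; simp)]
        at this) hε
  exact ⟨Φ, hΦ, (eLpNorm_mono_measure _ Measure.restrict_le_self).trans h1,
    (eLpNorm_mono_measure _ Measure.restrict_le_self).trans h2⟩

theorem IsTestFunction.cutoff_mem {ψ : EuclideanSpace ℝ (Fin N) → ℝ}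
    (hψ : IsTestFunction N ψ) (hp : p ≠ ∞) (u : W1p m N p) : hψ.cutoff u ∈ W1p0 m N p := by
  refine EMetric.mem_closure_iff.2 fun ε hε => ?_
  obtain ⟨ε', hε', hlt⟩ := exists_between hε
  obtain ⟨Φ, hΦ, h1, h2⟩ := hψ.exists_approx_cutoff hp u hε'
  refine ⟨hΦ.toW1p, hΦ.toW1p_mem_set, lt_of_le_of_lt ?_ hlt⟩
  rw [edist_comm]
  change edist (hΦ.toW1p (p := p)).1 (hψ.cutoff u).1 ≤ ε'
  rw [Prod.edist_eq]
  refine max_le ?_ ?_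
  · exact (Lp.edist_toLp_toLp _ _ (memLp_of_continuous N hΦ.1.continuous p)
      (hψ.memLp_smul_val u)).trans_le h1
  · exact (Lp.edist_toLp_toLp _ _ hΦ.memLp_matGrad (hψ.memLp_cutoffGrad u)).trans_le h2

theorem IsTestFunction.grad_cutoff {ψ : EuclideanSpace ℝ (Fin N) → ℝ}
    (hψ : IsTestFunction N ψ) (u : W1p m N p) :
    W1p.grad (hψ.cutoff u) =ᵐ[cubeMeasure N] cutoffGrad ψ u := W1p.grad_mk _ _ _

end Sobolev

/-! ### Weak convergence implies local uniform convergence when `p > N` -/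

section LocalUniform

variable {m N : ℕ} {p : ℝ≥0∞}

/-- The constant in Morrey's inequality on a ball of radius `δ` of `ℝ^N`. -/
noncomputable def morreyBallConst (N : ℕ) (q : ℝ) (δ : ℝ) : ℝ≥0∞ :=
  ENNReal.ofReal (2 * δ) * volume (Metric.ball (0 : EuclideanSpace ℝ (Fin N)) δ) ^ (1 - 1 / q) *
    morreyConst N q

theorem morreyBallConst_ne_top {q : ℝ} (hq : 1 ≤ q) (hNq : (N : ℝ) < q) (δ : ℝ) :
    morreyBallConst N q δ ≠ ∞ := by
  refine ENNReal.mul_ne_top (ENNReal.mul_ne_top ENNReal.ofReal_ne_top ?_)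
    (morreyConst_lt_top hNq).ne
  refine ENNReal.rpow_ne_top_of_nonneg ?_ measure_ball_lt_top.ne
  rw [sub_nonneg, div_le_one (by linarith)]
  exact hq

theorem IsTestFunction.setIntegral_cubeMeasure {F : Type*} [NormedAddCommGroup F]
    [NormedSpace ℝ F] {φ : EuclideanSpace ℝ (Fin N) → F} (hφ : IsTestFunction N φ)
    {B : Set (EuclideanSpace ℝ (Fin N))} (hB : MeasurableSet B) :
    ∫ y in B, φ y ∂cubeMeasure N = ∫ y in B, φ y := by
  rw [cubeMeasure, Measure.restrict_restrict hB]
  refine (setIntegral_eq_of_subset_of_forall_sdiff_eq_zero hB inter_subset_left fun y hy => ?_).symm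
  exact hφ.eq_zero_of_notMem fun h => hy.2 ⟨hy.1, h⟩

/-- The left side is the integral of `Φ x - Φ y` over the ball, to which Morrey's inequality applies
with diameter bound `2 * δ`. The ball may leave the cube, harmlessly, since `Φ` vanishes outside. -/
theorem IsTestFunction.enorm_sub_setIntegral_le
    {Φ : EuclideanSpace ℝ (Fin N) → EuclideanSpace ℝ (Fin m)} (hΦ : IsTestFunction N Φ)
    (hp1 : 1 ≤ p) (hp : p ≠ ∞) {c x : EuclideanSpace ℝ (Fin N)} {δ : ℝ}
    (hx : x ∈ Metric.ball c δ) :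
    ‖volume.real (Metric.ball c δ) • Φ x - ∫ y in Metric.ball c δ, Φ y ∂cubeMeasure N‖ₑ ≤
      morreyBallConst N p.toReal δ * eLpNorm (matGrad Φ) p (cubeMeasure N) := by
  have hp0 : p ≠ 0 := (one_pos.trans_le hp1).ne'
  have hq : 1 ≤ p.toReal := by simpa using ENNReal.toReal_mono hp hp1
  set B := Metric.ball c δ with hBdef
  have hB : MeasurableSet B := Metric.isOpen_ball.measurableSet
  have hΦi : IntegrableOn Φ B := (hΦ.1.continuous.integrable_of_hasCompactSupport hΦ.2.1).integrableOn
  have e1 : volume.real B • Φ x - ∫ y in B, Φ y ∂cubeMeasure N = ∫ y in B, (Φ x - Φ y) := by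
    have hci : IntegrableOn (fun _ => Φ x) B := integrableOn_const measure_ball_lt_top.ne
    rw [hΦ.setIntegral_cubeMeasure hB, integral_sub hci hΦi]
    simp
  have hd : ∀ y ∈ B, ‖y - x‖ₑ ≤ ENNReal.ofReal (2 * δ) := by
    intro y hy
    rw [← ofReal_norm, ← dist_eq_norm]
    refine ENNReal.ofReal_le_ofReal ?_
    have h1 := Metric.mem_ball.1 hy
    have h2 := Metric.mem_ball.1 hx
    linarith [dist_triangle_right y x c]
  have hC1 : ContDiff ℝ 1 Φ := hΦ.1.of_le (by simp)
  have key := lintegral_enorm_sub_le_morrey (μ := volume) hC1 hq hB hd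
  have hgrad : (∫⁻ y, ‖fderiv ℝ Φ y‖ₑ ^ p.toReal) ^ (1 / p.toReal) ≤
      eLpNorm (matGrad Φ) p (cubeMeasure N) := by
    have hz : ∀ y ∉ unitCube N, matGrad Φ y = 0 := fun y hy => by
      ext ⟨i, j⟩; simp [hΦ.fderiv_eq_zero_of_notMem hy]
    have hr : eLpNorm (matGrad Φ) p (cubeMeasure N) = eLpNorm (matGrad Φ) p volume :=
      eLpNorm_restrict_eq_of_support_subset (Function.support_subset_iff'.2 hz)
    rw [hr, eLpNorm_eq_lintegral_rpow_enorm_toReal hp0 hp]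
    gcongr with y
    exact enorm_le_iff_norm_le.2 (norm_fderiv_le_norm_matGrad Φ y)
  have hvol : volume B = volume (Metric.ball (0 : EuclideanSpace ℝ (Fin N)) δ) :=
    Measure.addHaar_ball_center _ _ _
  rw [e1]
  calc ‖∫ y in B, (Φ x - Φ y)‖ₑ ≤ ∫⁻ y in B, ‖Φ x - Φ y‖ₑ := enorm_integral_le_lintegral_enorm _
    _ = ∫⁻ y in B, ‖Φ y - Φ x‖ₑ := lintegral_congr fun y => enorm_sub_rev _ _
    _ ≤ _ := key
    _ ≤ _ := by
      rw [finrank_euclideanSpace_fin, hvol, morreyBallConst]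
      gcongr

/-- Passage to the limit in the smooth estimate: the approximants converge a.e. along a subsequence,
their ball integrals converge by `L^1` convergence, and their gradient norms are bounded in the
limit. -/
theorem IsTestFunction.ae_enorm_cutoff_sub_setIntegral_le [hp1 : Fact (1 ≤ p)] (hp : p ≠ ∞)
    (hNp : (N : ℝ≥0∞) < p) {ψ : EuclideanSpace ℝ (Fin N) → ℝ} (hψ : IsTestFunction N ψ)
    (u : W1p m N p) (c : EuclideanSpace ℝ (Fin N)) (δ : ℝ) :
    ∀ᵐ x ∂cubeMeasure N, x ∈ Metric.ball c δ →
      ‖volume.real (Metric.ball c δ) • (ψ x • W1p.val u x) -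
        ∫ y in Metric.ball c δ, ψ y • W1p.val u y ∂cubeMeasure N‖ₑ ≤
      morreyBallConst N p.toReal δ * eLpNorm (cutoffGrad ψ u) p (cubeMeasure N) := by
  have hp0 : p ≠ 0 := (one_pos.trans_le hp1.out).ne'
  have hq : 1 ≤ p.toReal := by simpa using ENNReal.toReal_mono hp hp1.out
  have hNq : (N : ℝ) < p.toReal := by simpa using ENNReal.toReal_strict_mono hp hNp
  set z : EuclideanSpace ℝ (Fin N) → EuclideanSpace ℝ (Fin m) := fun y => ψ y • W1p.val u y with hz
  have hzL : MemLp z p (cubeMeasure N) := hψ.memLp_smul_val u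
  have hε : ∀ k : ℕ, 0 < (k + 1 : ℝ≥0∞)⁻¹ := fun k => by simp
  choose Φ hΦ h1 h2 using fun k : ℕ => hψ.exists_approx_cutoff hp u (hε k)
  have hε0 : Tendsto (fun k : ℕ => (k + 1 : ℝ≥0∞)⁻¹) atTop (𝓝 0) := by
    refine ((ENNReal.tendsto_inv_nat_nhds_zero).comp (tendsto_add_atTop_nat 1)).congr fun k => ?_
    simp
  have hΦL : ∀ k q, MemLp (Φ k) q (cubeMeasure N) := fun k q =>
    memLp_of_continuous N (hΦ k).1.continuous q
  have hLp : Tendsto (fun k => eLpNorm (Φ k - z) p (cubeMeasure N)) atTop (𝓝 0) :=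
    tendsto_of_tendsto_of_tendsto_of_le_of_le tendsto_const_nhds hε0 (fun _ => zero_le) h1
  obtain ⟨ns, hns, hae⟩ := (tendstoInMeasure_of_tendsto_eLpNorm hp0
    (fun k => (hΦL k p).1) hzL.1 hLp).exists_seq_tendsto_ae
  have hL1 : Tendsto (fun k => eLpNorm (Φ k - z) 1 (cubeMeasure N)) atTop (𝓝 0) := by
    have hb : ∀ k, eLpNorm (Φ k - z) 1 (cubeMeasure N) ≤ eLpNorm (Φ k - z) p (cubeMeasure N) *
        cubeMeasure N univ ^ (1 / (1 : ℝ≥0∞).toReal - 1 / p.toReal) := fun k =>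
      eLpNorm_le_eLpNorm_mul_rpow_measure_univ hp1.out ((hΦL k p).1.sub hzL.1)
    have hfin : cubeMeasure N univ ^ (1 / (1 : ℝ≥0∞).toReal - 1 / p.toReal) ≠ ∞ := by
      refine ENNReal.rpow_ne_top_of_nonneg ?_ (measure_ne_top _ _)
      simp only [ENNReal.toReal_one, div_one, sub_nonneg]
      rw [div_le_one (by linarith)]
      exact hq
    refine tendsto_of_tendsto_of_tendsto_of_le_of_le tendsto_const_nhds ?_ (fun _ => zero_le) hb
    simpa using ENNReal.Tendsto.mul_const hLp (Or.inr hfin)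
  have hint : Tendsto (fun k => ∫ y in Metric.ball c δ, Φ k y ∂cubeMeasure N) atTop
      (𝓝 (∫ y in Metric.ball c δ, z y ∂cubeMeasure N)) :=
    tendsto_setIntegral_of_L1' z (hzL.integrable hp1.out).1
      (Eventually.of_forall fun k => memLp_one_iff_integrable.1 (hΦL k 1)) hL1 _
  have hR : Tendsto (fun k : ℕ => morreyBallConst N p.toReal δ *
      (eLpNorm (cutoffGrad ψ u) p (cubeMeasure N) + (k + 1 : ℝ≥0∞)⁻¹)) atTop
      (𝓝 (morreyBallConst N p.toReal δ * eLpNorm (cutoffGrad ψ u) p (cubeMeasure N))) := by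
    refine ENNReal.Tendsto.const_mul ?_ (Or.inr (morreyBallConst_ne_top hq hNq δ))
    simpa using hε0.const_add (eLpNorm (cutoffGrad ψ u) p (cubeMeasure N))
  have hgk : ∀ k, eLpNorm (matGrad (Φ k)) p (cubeMeasure N) ≤
      eLpNorm (cutoffGrad ψ u) p (cubeMeasure N) + (k + 1 : ℝ≥0∞)⁻¹ := by
    intro k
    have e : matGrad (Φ k) = cutoffGrad ψ u + (fun y => matGrad (Φ k) y - cutoffGrad ψ u y) := by
      ext y; simp
    calc eLpNorm (matGrad (Φ k)) p (cubeMeasure N)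
        = eLpNorm (cutoffGrad ψ u + fun y => matGrad (Φ k) y - cutoffGrad ψ u y) p
          (cubeMeasure N) := by rw [← e]
      _ ≤ _ := eLpNorm_add_le (hψ.memLp_cutoffGrad u).1
          (((hΦ k).memLp_matGrad (p := p)).1.sub (hψ.memLp_cutoffGrad u).1) hp1.out
      _ ≤ _ := by gcongr; exact h2 k
  filter_upwards [hae] with x hx hxB
  have hlim : Tendsto (fun k => ‖volume.real (Metric.ball c δ) • Φ (ns k) x -
      ∫ y in Metric.ball c δ, Φ (ns k) y ∂cubeMeasure N‖ₑ) atTop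
      (𝓝 ‖volume.real (Metric.ball c δ) • z x - ∫ y in Metric.ball c δ, z y ∂cubeMeasure N‖ₑ) :=
    ((hx.const_smul _).sub (hint.comp hns.tendsto_atTop)).enorm
  refine le_of_tendsto_of_tendsto' hlim (hR.comp hns.tendsto_atTop) fun k => ?_
  refine ((hΦ (ns k)).enorm_sub_setIntegral_le hp1.out hp hxB).trans ?_
  simp only [Function.comp_apply]
  gcongr
  exact hgk (ns k)

/-- Uniform boundedness applied to the `u n` seen as functionals on the dual, followed by the
isometry into the bidual. -/
theorem WeaklyConverges.exists_norm_le {X : Type*} [NormedAddCommGroup X] [NormedSpace ℝ X]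
    {u : ℕ → X} {x : X} (h : WeaklyConverges u x) : ∃ C : ℝ, ∀ n, ‖u n‖ ≤ C := by
  obtain ⟨C, hC⟩ := banach_steinhaus (g := fun n => NormedSpace.inclusionInDoubleDual ℝ X (u n))
    fun f => by
      obtain ⟨C, hC⟩ := (h f).norm.bddAbove_range
      exact ⟨C, fun n => hC ⟨n, rfl⟩⟩
  refine ⟨C, fun n => ?_⟩
  rw [← (NormedSpace.inclusionInDoubleDualLi ℝ (E := X)).norm_map (u n)]
  exact hC n

theorem WeaklyConverges.sub_const {X : Type*} [NormedAddCommGroup X] [NormedSpace ℝ X]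
    {u : ℕ → X} {x : X} (h : WeaklyConverges u x) (a : X) :
    WeaklyConverges (fun n => u n - a) (x - a) := fun f => by
  simpa using (h f).sub_const (f a)

variable [hp1 : Fact (1 ≤ p)]

/-- Continuity makes these local integrals accessible to weak convergence. -/
theorem IsTestFunction.exists_setIntegral_clm {ψ : EuclideanSpace ℝ (Fin N) → ℝ}
    (hψ : IsTestFunction N ψ) (B : Set (EuclideanSpace ℝ (Fin N))) :
    ∃ T : W1p m N p →L[ℝ] EuclideanSpace ℝ (Fin m),
      ∀ u, T u = ∫ y in B, ψ y • W1p.val u y ∂cubeMeasure N := by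
  obtain ⟨C, hC0, hC⟩ := hψ.exists_norm_le
  have hi : ∀ u : W1p m N p, Integrable (fun y => ψ y • W1p.val u y) (cubeMeasure N) := fun u =>
    (hψ.memLp_smul_val u).integrable hp1.out
  let T₀ : W1p m N p →ₗ[ℝ] EuclideanSpace ℝ (Fin m) :=
    { toFun := fun u => ∫ y in B, ψ y • W1p.val u y ∂cubeMeasure N
      map_add' := fun u w => by
        rw [← integral_add (hi u).integrableOn (hi w).integrableOn]
        refine integral_congr_ae (ae_restrict_of_ae ?_)
        filter_upwards [W1p.val_add u w] with y hy
        rw [hy, smul_add]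
      map_smul' := fun c u => by
        rw [RingHom.id_apply, ← integral_smul]
        refine integral_congr_ae (ae_restrict_of_ae ?_)
        filter_upwards [W1p.val_smul c u] with y hy
        rw [hy, smul_comm] }
  set M : ℝ≥0∞ := cubeMeasure N univ ^ (1 / (1 : ℝ≥0∞).toReal - 1 / p.toReal) with hM
  have hMtop : M ≠ ∞ := by
    refine ENNReal.rpow_ne_top_of_nonneg ?_ (measure_ne_top _ _)
    simp only [ENNReal.toReal_one, div_one, sub_nonneg]
    rcases eq_or_ne p ∞ with rfl | hp
    · simp
    have hq : 1 ≤ p.toReal := by simpa using ENNReal.toReal_mono hp hp1.out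
    rw [div_le_one (by linarith)]
    exact hq
  refine ⟨T₀.mkContinuous (C * M.toReal) fun u => ?_, fun u => rfl⟩
  have h1 : ‖T₀ u‖ₑ ≤ ENNReal.ofReal C * (eLpNorm (W1p.val u) p (cubeMeasure N) * M) := by
    calc ‖T₀ u‖ₑ ≤ ∫⁻ y in B, ‖ψ y • W1p.val u y‖ₑ ∂cubeMeasure N :=
          enorm_integral_le_lintegral_enorm _
      _ ≤ ∫⁻ y, ‖ψ y • W1p.val u y‖ₑ ∂cubeMeasure N := setLIntegral_le_lintegral _ _
      _ = eLpNorm (fun y => ψ y • W1p.val u y) 1 (cubeMeasure N) :=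
          eLpNorm_one_eq_lintegral_enorm.symm
      _ ≤ ENNReal.ofReal C * eLpNorm (W1p.val u) 1 (cubeMeasure N) := by
          refine eLpNorm_le_mul_eLpNorm_of_ae_le_mul (Eventually.of_forall fun y => ?_) 1
          rw [norm_smul]
          gcongr
          exact hC y
      _ ≤ _ := by
          gcongr
          exact eLpNorm_le_eLpNorm_mul_rpow_measure_univ hp1.out (W1p.memLp_val u).1
  have h2 : (eLpNorm (W1p.val u) p (cubeMeasure N)).toReal ≤ ‖u‖ := norm_fst_le u.1
  have h3 := ENNReal.toReal_mono (ENNReal.mul_ne_top ENNReal.ofReal_ne_top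
    (ENNReal.mul_ne_top (W1p.memLp_val u).eLpNorm_ne_top hMtop)) h1
  rw [toReal_enorm, ENNReal.toReal_mul, ENNReal.toReal_mul, ENNReal.toReal_ofReal hC0] at h3
  calc ‖T₀ u‖ ≤ C * ((eLpNorm (W1p.val u) p (cubeMeasure N)).toReal * M.toReal) := h3
    _ ≤ C * (‖u‖ * M.toReal) := by gcongr
    _ = _ := by ring

/-- Scaling: the quotient is a constant times `δ^(1 - N/q)`, whose exponent is positive. -/
theorem tendsto_morreyBallConst_div {q : ℝ} (hq : 1 ≤ q) (hNq : (N : ℝ) < q) (C : ℝ) :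
    Tendsto (fun δ : ℝ => (morreyBallConst N q δ).toReal * C /
      volume.real (Metric.ball (0 : EuclideanSpace ℝ (Fin N)) δ)) (𝓝[>] 0) (𝓝 0) := by
  have hq0 : 0 < q := by linarith
  set V := volume.real (Metric.ball (0 : EuclideanSpace ℝ (Fin N)) 1) with hV
  have hV0 : 0 < V := ENNReal.toReal_pos (Metric.measure_ball_pos _ _ one_pos).ne'
    measure_ball_lt_top.ne
  have hball : ∀ δ : ℝ, 0 < δ →
      volume.real (Metric.ball (0 : EuclideanSpace ℝ (Fin N)) δ) = δ ^ (N : ℝ) * V := by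
    intro δ hδ
    rw [Measure.real, Measure.addHaar_ball_of_pos _ _ hδ, finrank_euclideanSpace_fin, ENNReal.toReal_mul,
      ENNReal.toReal_ofReal (by positivity), Real.rpow_natCast]
    rfl
  have hlim : Tendsto (fun δ : ℝ => δ ^ (1 - N / q) *
      (2 * V ^ (-(1 / q)) * (morreyConst N q).toReal * C)) (𝓝[>] 0) (𝓝 0) := by
    have he : 0 < 1 - N / q := by rw [sub_pos, div_lt_one hq0]; exact hNq
    have h1 := (Real.continuousAt_rpow_const 0 (1 - N / q) (Or.inr he.le)).tendsto
    rw [Real.zero_rpow he.ne'] at h1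
    simpa using (h1.mono_left nhdsWithin_le_nhds).mul_const
      (2 * V ^ (-(1 / q)) * (morreyConst N q).toReal * C)
  refine hlim.congr' ?_
  filter_upwards [self_mem_nhdsWithin] with δ hδ
  have hδ : 0 < δ := hδ
  have hW : 0 < δ ^ (N : ℝ) * V := by positivity
  have e1 : (morreyBallConst N q δ).toReal =
      2 * δ * (δ ^ (N : ℝ) * V) ^ (1 - 1 / q) * (morreyConst N q).toReal := by
    rw [morreyBallConst, ENNReal.toReal_mul, ENNReal.toReal_mul, ← ENNReal.toReal_rpow,
      ← Measure.real, hball δ hδ, ENNReal.toReal_ofReal (by positivity)]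
  rw [e1, hball δ hδ, sub_eq_add_neg 1 (1 / q), Real.rpow_add hW, Real.rpow_one,
    Real.mul_rpow (by positivity) hV0.le, ← Real.rpow_mul hδ.le, sub_eq_add_neg, Real.rpow_add hδ,
    Real.rpow_one, show (N : ℝ) * -(1 / q) = -(N / q) by ring]
  field_simp

/-- Locally in the cube, weak convergence in `W^{1,p}`, `p > N`, implies uniform convergence. -/
theorem IsTestFunction.eventually_ae_norm_smul_le (hp : p ≠ ∞) (hNp : (N : ℝ≥0∞) < p)
    {ψ : EuclideanSpace ℝ (Fin N) → ℝ} (hψ : IsTestFunction N ψ) {u : ℕ → W1p m N p}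
    (hu : WeaklyConverges u 0) {η : ℝ} (hη : 0 < η) :
    ∀ᶠ n in atTop, ∀ᵐ y ∂cubeMeasure N, ‖ψ y • W1p.val (u n) y‖ ≤ η := by
  have hq : 1 ≤ p.toReal := by simpa using ENNReal.toReal_mono hp hp1.out
  have hNq : (N : ℝ) < p.toReal := by simpa using ENNReal.toReal_strict_mono hp hNp
  obtain ⟨C₀, hC₀⟩ := hu.exists_norm_le
  obtain ⟨C₁, hC₁⟩ := hψ.exists_eLpNorm_cutoffGrad_le (m := m) (p := p)
  set C : ℝ := C₁ * C₀ with hC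
  have hCn : ∀ n, (eLpNorm (cutoffGrad ψ (u n)) p (cubeMeasure N)).toReal ≤ C := by
    intro n
    have := ENNReal.toReal_mono (ENNReal.mul_ne_top ENNReal.coe_ne_top ENNReal.ofReal_ne_top)
      (hC₁ (u n))
    rw [ENNReal.toReal_mul, ENNReal.toReal_ofReal (norm_nonneg _), ENNReal.coe_toReal] at this
    refine this.trans ?_
    rw [hC]
    gcongr
    exact hC₀ n
  -- The radius `δ` makes the deviation from the ball average at most `η / 2` for every `n` at once.
  -- Finitely many such balls cover the cube, and weak convergence eventually puts their finitely
  -- many averages below `η / 2`.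
  obtain ⟨δ, hδ, hδ0⟩ := (((tendsto_morreyBallConst_div hq hNq C).eventually_lt_const
    (half_pos hη)).and self_mem_nhdsWithin).exists
  have hδ0 : 0 < δ := hδ0
  set V := volume.real (Metric.ball (0 : EuclideanSpace ℝ (Fin N)) δ) with hV
  have hV0 : 0 < V := ENNReal.toReal_pos (Metric.measure_ball_pos _ _ hδ0).ne'
    measure_ball_lt_top.ne
  obtain ⟨t, -, htf, htc⟩ := (isCompact_bigCube N).finite_cover_balls hδ0
  have hcen : ∀ c, ∀ᶠ n in atTop,
      ‖∫ y in Metric.ball c δ, ψ y • W1p.val (u n) y ∂cubeMeasure N‖ ≤ V * (η / 2) := by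
    intro c
    obtain ⟨T, hT⟩ := hψ.exists_setIntegral_clm (m := m) (p := p) (Metric.ball c δ)
    have hlim : Tendsto (fun n => T (u n)) atTop (𝓝 0) := by
      have h1 : Tendsto (fun n => (EuclideanSpace.equiv (Fin m) ℝ) (T (u n))) atTop (𝓝 0) := by
        rw [tendsto_pi_nhds]
        intro i
        have := hu ((EuclideanSpace.proj (𝕜 := ℝ) i).comp T)
        simpa using this
      have h2 := ((EuclideanSpace.equiv (Fin m) ℝ).symm.continuous.tendsto 0).comp h1
      simpa [Function.comp_def] using h2
    have := (tendsto_zero_iff_norm_tendsto_zero.1 hlim).eventually_le_const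
      (show 0 < V * (η / 2) by positivity)
    filter_upwards [this] with n hn
    rwa [← hT]
  filter_upwards [(eventually_all_finite htf).2 fun c _ => hcen c] with n hn
  have hall : ∀ᵐ x ∂cubeMeasure N, ∀ c ∈ t, x ∈ Metric.ball c δ →
      ‖volume.real (Metric.ball c δ) • (ψ x • W1p.val (u n) x) -
        ∫ y in Metric.ball c δ, ψ y • W1p.val (u n) y ∂cubeMeasure N‖ₑ ≤
      morreyBallConst N p.toReal δ * eLpNorm (cutoffGrad ψ (u n)) p (cubeMeasure N) :=
    (ae_ball_iff htf.countable).2 fun c _ =>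
      hψ.ae_enorm_cutoff_sub_setIntegral_le hp hNp (u n) c δ
  filter_upwards [hall, ae_restrict_mem (isOpen_unitCube N).measurableSet] with x hx hxY
  obtain ⟨c, hct, hxc⟩ := mem_iUnion₂.1 (htc (unitCube_subset_Icc N hxY))
  have h1 := ENNReal.toReal_mono (ENNReal.mul_ne_top (morreyBallConst_ne_top hq hNq δ)
    (hψ.memLp_cutoffGrad (u n)).eLpNorm_ne_top) (hx c hct hxc)
  have hVc : volume.real (Metric.ball c δ) = V := by
    rw [hV, Measure.real, Measure.real, Measure.addHaar_ball_center]
  rw [toReal_enorm, ENNReal.toReal_mul, hVc] at h1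
  have h2 : (morreyBallConst N p.toReal δ).toReal *
      (eLpNorm (cutoffGrad ψ (u n)) p (cubeMeasure N)).toReal ≤ V * (η / 2) := by
    rw [div_lt_iff₀ hV0] at hδ
    calc _ ≤ (morreyBallConst N p.toReal δ).toReal * C := by gcongr; exact hCn n
      _ ≤ V * (η / 2) := by linarith
  have h3 : ‖V • (ψ x • W1p.val (u n) x)‖ ≤ V * η := by
    have := norm_le_norm_sub_add (V • (ψ x • W1p.val (u n) x))
      (∫ y in Metric.ball c δ, ψ y • W1p.val (u n) y ∂cubeMeasure N)
    linarith [hn c hct]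
  rw [norm_smul, Real.norm_of_nonneg hV0.le] at h3
  exact le_of_mul_le_mul_left h3 hV0

end LocalUniform

/-! ### Cut-off functions, consequences of (D₁), and the competitor -/

section OneStep

open scoped Manifold

variable {m N : ℕ}

/-- A smooth Urysohn function whose support is exactly `U`, so its topological support is `closure
U`. -/
theorem exists_testFunction_eq_one {K U : Set (EuclideanSpace ℝ (Fin N))} (hK : IsClosed K)
    (hU : IsOpen U) (hKU : K ⊆ U) (hUc : IsCompact (closure U)) (hUY : closure U ⊆ unitCube N) :
    ∃ φ : EuclideanSpace ℝ (Fin N) → ℝ, IsTestFunction N φ ∧ (∀ y, 0 ≤ φ y ∧ φ y ≤ 1) ∧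
      (∀ y ∈ K, φ y = 1) ∧ ∀ y ∉ U, φ y = 0 := by
  obtain ⟨φ, hφ, hr, hs, h1⟩ := exists_contMDiff_support_eq_eq_one_iff (n := (⊤ : ℕ∞))
    𝓘(ℝ, EuclideanSpace ℝ (Fin N)) hU hK hKU
  have ht : tsupport φ = closure U := by rw [tsupport, hs]
  refine ⟨φ, ⟨hφ.contDiff, by rw [HasCompactSupport, ht]; exact hUc, ht ▸ hUY⟩,
    fun y => hr ⟨y, rfl⟩, fun y hy => (h1 y).1 hy, fun y hy => ?_⟩
  rw [← hs] at hy
  simpa using hy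

/-- Such a point is a maximum, so the derivative vanishes on all of `K`, not merely in its interior.
-/
theorem fderiv_eq_zero_of_eq_one {E : Type*} [NormedAddCommGroup E] [NormedSpace ℝ E] {φ : E → ℝ}
    (h : ∀ y, 0 ≤ φ y ∧ φ y ≤ 1) {y : E} (hy : φ y = 1) : fderiv ℝ φ y = 0 :=
  IsLocalMax.fderiv_eq_zero (Eventually.of_forall fun z => hy ▸ (h z).2)

theorem fderiv_eq_zero_of_eq_zero {E : Type*} [NormedAddCommGroup E] [NormedSpace ℝ E] {φ : E → ℝ}
    (h : ∀ y, 0 ≤ φ y ∧ φ y ≤ 1) {y : E} (hy : φ y = 0) : fderiv ℝ φ y = 0 :=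
  IsLocalMin.fderiv_eq_zero (Eventually.of_forall fun z => hy ▸ (h z).1)

theorem contDiff_linFun (ξ : Mat m N) : ContDiff ℝ (⊤ : ℕ∞) (linFun ξ) := by
  rw [contDiff_euclidean]
  intro i
  simp only [linFun]
  fun_prop

theorem matGrad_linFun (ξ : Mat m N) (y : EuclideanSpace ℝ (Fin N)) : matGrad (linFun ξ) y = ξ := by
  ext ⟨i, j⟩
  let T : EuclideanSpace ℝ (Fin N) →L[ℝ] ℝ := ∑ k, ξ (i, k) • EuclideanSpace.proj (𝕜 := ℝ) k
  have hT : (fun y => linFun ξ y i) = T := by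
    ext y; simp [T, linFun]
  have hd := ((contDiff_linFun ξ).differentiable (by simp)) y
  have h1 : HasFDerivAt (fun y => linFun ξ y i)
      ((EuclideanSpace.proj (𝕜 := ℝ) i).comp (fderiv ℝ (linFun ξ) y)) y :=
    (EuclideanSpace.proj (𝕜 := ℝ) i).hasFDerivAt.comp y hd.hasFDerivAt
  rw [hT] at h1
  have h2 := congrArg (fun D => D (EuclideanSpace.single j 1)) (h1.unique T.hasFDerivAt)
  have h3 : T (EuclideanSpace.single j 1) = ξ (i, j) := by simp [T]
  rw [← h3, ← h2]
  rfl

theorem IsTestFunction.smul_linFun {ψ : EuclideanSpace ℝ (Fin N) → ℝ} (hψ : IsTestFunction N ψ)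
    (ξ : Mat m N) : IsTestFunction N (fun y => ψ y • linFun ξ y) :=
  ⟨hψ.1.smul (contDiff_linFun ξ), hψ.2.1.smul_right, (tsupport_smul_subset_left _ _).trans hψ.2.2⟩

theorem exists_bound_on_ball {L : Mat m N → ℝ≥0∞} (hcont : Continuous L)
    (hfin : ∀ ξ, L ξ < ∞) (R : ℝ) : ∃ M : ℝ≥0, ∀ ξ, ‖ξ‖ ≤ R → L ξ ≤ M := by
  rcases (Metric.closedBall (0 : Mat m N) R).eq_empty_or_nonempty with h | h
  · refine ⟨0, fun ξ hξ => ?_⟩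
    have : ξ ∈ Metric.closedBall (0 : Mat m N) R := by simpa using hξ
    simp [h] at this
  · obtain ⟨x, -, hx⟩ := (isCompact_closedBall (0 : Mat m N) R).exists_isMaxOn h hcont.continuousOn
    refine ⟨(L x).toNNReal, fun ξ hξ => ?_⟩
    rw [ENNReal.coe_toNNReal (hfin x).ne]
    exact hx (by simpa using hξ)

/-- (D₁) frozen at one large radius: a single factor, as close to one as desired, gains `δ` on all
large matrices. -/
theorem exists_scaling {L : Mat m N → ℝ≥0∞} (hfin : ∀ ξ, L ξ < ∞)
    (hD1 : ∃ lam : ℝ → ℝ, (∀ R, 0 < R → 0 < lam R ∧ lam R < 1) ∧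
      Tendsto lam atTop (𝓝 1) ∧
      Tendsto (fun R : ℝ => ⨆ (ξ : Mat m N) (_ : R ≤ ‖ξ‖), L (lam R • ξ) / L ξ) atTop (𝓝 0))
    {δ κ : ℝ} (hδ : 0 < δ) (hκ : 0 < κ) :
    ∃ R l : ℝ, 0 < l ∧ l < 1 ∧ 1 - κ < l ∧
      ∀ ξ : Mat m N, R ≤ ‖ξ‖ → L (l • ξ) ≤ ENNReal.ofReal δ * L ξ := by
  obtain ⟨lam, h1, h2, h3⟩ := hD1
  have e1 := h2.eventually_const_lt (show 1 - κ < 1 by linarith)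
  have e2 := h3.eventually_le_const (ENNReal.ofReal_pos.2 hδ)
  obtain ⟨R, ⟨hR1, hR2⟩, hR0⟩ := ((e1.and e2).and (eventually_gt_atTop 0)).exists
  refine ⟨R, lam R, (h1 R hR0).1, (h1 R hR0).2, hR1, fun ξ hξ => ?_⟩
  have := (le_iSup₂ (f := fun (ξ : Mat m N) (_ : R ≤ ‖ξ‖) => L (lam R • ξ) / L ξ) ξ hξ).trans hR2
  -- The case `L ξ = 0` is included: `a / 0 = ∞` for `a ≠ 0`, which a finite bound excludes.
  rwa [ENNReal.div_le_iff_le_mul (Or.inr ENNReal.ofReal_ne_top) (Or.inl (hfin ξ).ne)] at this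

variable {p : ℝ≥0∞} [hp1 : Fact (1 ≤ p)]

/-- The competitor `l_ξ - (1 - l) ψ l_ξ + l φ (v - l_ξ)`. -/
noncomputable def competitor (ξ : Mat m N) (l : ℝ) {ψ φ : EuclideanSpace ℝ (Fin N) → ℝ}
    (hψ : IsTestFunction N ψ) (hφ : IsTestFunction N φ) (v : W1p m N p) : W1p m N p :=
  linW m N p ξ + (-(1 - l) • (hψ.smul_linFun ξ).toW1p + l • hφ.cutoff (v - linW m N p ξ))

theorem competitor_sub_mem (hp : p ≠ ∞) (ξ : Mat m N) (l : ℝ)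
    {ψ φ : EuclideanSpace ℝ (Fin N) → ℝ} (hψ : IsTestFunction N ψ) (hφ : IsTestFunction N φ)
    (v : W1p m N p) : competitor ξ l hψ hφ v - linW m N p ξ ∈ W1p0 m N p := by
  rw [competitor, add_sub_cancel_left]
  exact W1p0_add (W1p0_smul _ (hψ.smul_linFun ξ).toW1p_mem) (W1p0_smul _ (hφ.cutoff_mem hp _))

theorem grad_competitor (ξ : Mat m N) (l : ℝ) {ψ φ : EuclideanSpace ℝ (Fin N) → ℝ}
    (hψ : IsTestFunction N ψ) (hφ : IsTestFunction N φ) (v : W1p m N p) :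
    W1p.grad (competitor ξ l hψ hφ v) =ᵐ[cubeMeasure N] fun y =>
      ξ - (1 - l) • matGrad (fun y => ψ y • linFun ξ y) y +
        l • (φ y • (W1p.grad v y - ξ) +
          tensor (W1p.val (v - linW m N p ξ) y) (fderiv ℝ φ y)) := by
  filter_upwards [W1p.grad_add (linW m N p ξ) (-(1 - l) • (hψ.smul_linFun ξ).toW1p +
      l • hφ.cutoff (v - linW m N p ξ)),
    W1p.grad_add (-(1 - l) • (hψ.smul_linFun ξ).toW1p) (l • hφ.cutoff (v - linW m N p ξ)),
    W1p.grad_smul (-(1 - l)) ((hψ.smul_linFun ξ).toW1p (p := p)),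
    W1p.grad_smul l (hφ.cutoff (v - linW m N p ξ)),
    (hψ.smul_linFun ξ).grad_toW1p (p := p), hφ.grad_cutoff (v - linW m N p ξ),
    W1p.grad_sub v (linW m N p ξ), W1p.grad_linW (p := p) ξ] with y h1 h2 h3 h4 h5 h6 h7 h8
  rw [competitor, h1, h2, h3, h4, h5, h6, cutoffGrad, h7, h8, neg_smul]
  abel

end OneStep

/-! ### Energy estimate for the competitor -/

section Competitors

variable {m N : ℕ}

/-- Inner regularity gives a compact set almost filling the cube, and local compactness an open set
between the two. -/
theorem exists_nested_sets (N : ℕ) {δ : ℝ≥0∞} (hδ : 0 < δ) :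
    ∃ U : Set (EuclideanSpace ℝ (Fin N)), IsOpen U ∧ IsCompact (closure U) ∧
      closure U ⊆ unitCube N ∧ cubeMeasure N Uᶜ ≤ δ := by
  have hY := isOpen_unitCube N
  have hYfin : volume (unitCube N) ≠ ∞ := by
    have := measure_ne_top (cubeMeasure N) univ
    rwa [cubeMeasure, Measure.restrict_apply_univ] at this
  obtain ⟨K, hKY, hK, hKδ⟩ := hY.measurableSet.exists_isCompact_sdiff_lt hYfin hδ.ne'
  obtain ⟨U, hU, hKU, hUY, hUc⟩ := exists_open_between_and_isCompact_closure hK hY hKY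
  refine ⟨U, hU, hUc, hUY, ?_⟩
  rw [cubeMeasure, Measure.restrict_apply hU.measurableSet.compl]
  refine (measure_mono ?_).trans hKδ.le
  exact fun y hy => ⟨hy.2, fun h => hy.1 (hKU h)⟩

/-- Estimate of `L` at a convex combination of `l ξ` and `l G`, up to a small error. -/
theorem le_of_growth {L : Mat m N → ℝ≥0∞} {α₂ M : ℝ≥0} {ε c r l' s : ℝ} {ξ G e : Mat m N}
    (hr0 : 0 ≤ r) (hr1 : r ≤ 1) (hl'0 : 0 ≤ l') (hl'1 : l' ≤ 1) (hs0 : 0 ≤ s) (hs1 : s ≤ 1)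
    (hc : ∀ (t : ℝ) (ζ e : Mat m N), 0 ≤ t → t ≤ r → c ≤ ‖ζ‖ → ‖e‖ ≤ ε →
      L ((r * l') • ξ + t • ζ + e) ≤ α₂ * (1 + L ((r * l') • ξ + ζ)))
    (hM : ∀ η : Mat m N, ‖η‖ ≤ ‖ξ‖ + c + ε → L η ≤ M)
    (he : ‖e‖ + (1 - r) * ‖ξ‖ ≤ ε) :
    L (ξ - (1 - r * l') • ξ + ((r * l') • (s • (G - ξ)) + e)) ≤
      α₂ * (1 + L (l' • G)) + M := by
  -- Chosen so that the base point `(r * l') • ξ` plus `ζ` is exactly `l' • G`, where (D₁) acts.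
  -- Writing the gradient with coefficient `s * r ≤ r < 1` on `ζ` leaves a multiple of `ξ` of size
  -- at most `1 - r`, absorbed in `e'`.
  set ζ : Mat m N := l' • G - (r * l') • ξ with hζ
  set e' : Mat m N := e - (s * (r * l') * (1 - r)) • ξ with he'
  have hid : ξ - (1 - r * l') • ξ + ((r * l') • (s • (G - ξ)) + e) =
      (r * l') • ξ + (s * r) • ζ + e' := by
    rw [hζ, he']
    module
  have hsr0 : 0 ≤ s * r := mul_nonneg hs0 hr0
  have hsr1 : s * r ≤ r := mul_le_of_le_one_left hr0 hs1
  have hrl0 : 0 ≤ r * l' := mul_nonneg hr0 hl'0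
  have hrl1 : r * l' ≤ 1 := mul_le_one₀ hr1 hl'0 hl'1
  have he'ε : ‖e'‖ ≤ ε := by
    refine (norm_sub_le _ _).trans (le_trans ?_ he)
    have h1r : 0 ≤ 1 - r := by linarith
    rw [norm_smul, Real.norm_of_nonneg (by positivity)]
    gcongr
    exact mul_le_of_le_one_left h1r (mul_le_one₀ hs1 hrl0 hrl1)
  rw [hid]
  -- For large `ζ` the growth condition applies; for small `ζ` the argument of `L` stays in a fixed
  -- ball.
  rcases le_or_gt c ‖ζ‖ with h | h
  · refine (hc (s * r) ζ e' hsr0 hsr1 h he'ε).trans ?_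
    rw [hζ, add_sub_cancel]
    exact le_self_add
  · refine (hM _ ?_).trans le_add_self
    refine (norm_add₃_le).trans ?_
    have h1 : ‖(r * l') • ξ‖ ≤ ‖ξ‖ := by
      rw [norm_smul, Real.norm_of_nonneg hrl0]
      exact mul_le_of_le_one_left (norm_nonneg _) hrl1
    have h2 : ‖(s * r) • ζ‖ ≤ c := by
      rw [norm_smul, Real.norm_of_nonneg hsr0]
      exact (mul_le_of_le_one_left (norm_nonneg _) (hsr1.trans hr1)).trans h.le
    linarith

/-- One constant for all regions, independent of `d`. `M₀` comes from outside `U`, the `α₁` in `α₁ +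
α₂` from (D₂) on `K`, and `α₂` from (D₃) in the layer. -/
theorem le_affine_of_le_or_le {x X h f d : ℝ≥0∞} {M₀ α₁ α₂ : ℝ≥0}
    (hX : X ≤ α₁ * (1 + h) + d * f) (hx : x ≤ M₀ ∨ x ≤ (α₁ + α₂) * (1 + X)) :
    x ≤ (M₀ + (α₁ + α₂) * (1 + α₁) : ℝ≥0) * (1 + h) +
      (M₀ + (α₁ + α₂) * (1 + α₁) : ℝ≥0) * d * f := by
  push_cast
  rcases hx with hx | hx
  · calc x ≤ M₀ * 1 := by simpa using hx
      _ ≤ (M₀ + (α₁ + α₂) * (1 + α₁)) * (1 + h) := by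
        gcongr
        · exact le_self_add
        · exact le_self_add
      _ ≤ _ := le_self_add
  · calc x ≤ (α₁ + α₂) * (1 + X) := hx
      _ ≤ (α₁ + α₂) * ((1 + h) + (α₁ * (1 + h) + d * f)) := by
        gcongr
        exact le_self_add
      _ = ((α₁ + α₂) * (1 + α₁)) * (1 + h) + (α₁ + α₂) * 1 * d * f := by ring
      _ ≤ _ := by
        gcongr
        · exact le_add_self
        · refine le_trans ?_ le_add_self
          gcongr
          exact le_self_add

variable {p : ℝ≥0∞} [hp1 : Fact (1 ≤ p)]

-- The order of choices is essential: first `U` and `ψ`, then the factors `r` and `l'`, then the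
-- constants from (D₃), then `K` and `φ`, and only at the end `n`. The constant `A` precedes `δ`, so
-- that `A * δ` can tend to zero.
set_option maxHeartbeats 800000 in
theorem exists_competitor {L : Mat m N → ℝ≥0∞}
    (hcont : Continuous L) (hfin : ∀ ξ, L ξ < ∞)
    (hD1 : ∃ lam : ℝ → ℝ, (∀ R, 0 < R → 0 < lam R ∧ lam R < 1) ∧
      Tendsto lam atTop (𝓝 1) ∧
      Tendsto (fun R : ℝ => ⨆ (ξ : Mat m N) (_ : R ≤ ‖ξ‖), L (lam R • ξ) / L ξ) atTop (𝓝 0))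
    {α₁ : ℝ≥0} (hD2 : ∀ (ξ : Mat m N) (t : ℝ), 0 < t → t < 1 → L (t • ξ) ≤ α₁ * (1 + L ξ))
    {α₂ : ℝ≥0} {ε : ℝ} (hε : 0 < ε)
    (hD3 : ∀ (ξ : Mat m N) (t : ℝ), 0 ≤ t → t < 1 →
      ∃ c : ℝ, 0 < c ∧ ∀ (s : ℝ) (ζ e : Mat m N), 0 ≤ s → s ≤ t → c ≤ ‖ζ‖ → ‖e‖ ≤ ε →
        L (ξ + s • ζ + e) ≤ α₂ * (1 + L (ξ + ζ)))
    (hp : p ≠ ∞) (hNp : (N : ℝ≥0∞) < p) {ξ : Mat m N} {v : ℕ → W1p m N p}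
    (hv : WeaklyConverges v (linW m N p ξ)) :
    ∃ A : ℝ≥0, ∀ δ : ℝ, 0 < δ → ∃ k₀ : ℕ, ∀ᶠ n in atTop, ∃ w : W1p m N p,
      w - linW m N p ξ ∈ W1p0 m N p ∧
      (∃ g : EuclideanSpace ℝ (Fin N) → ℝ≥0∞, AEMeasurable g (cubeMeasure N) ∧
        ∫⁻ y, g y ∂cubeMeasure N ≤ ENNReal.ofReal δ ∧
        ∀ᵐ y ∂cubeMeasure N, L (W1p.grad w y) ≤
          A * (1 + min (L (W1p.grad (v n) y)) k₀) +
            (A * ENNReal.ofReal δ * L (W1p.grad (v n) y) + g y)) ∧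
      ∃ K : Set (EuclideanSpace ℝ (Fin N)), cubeMeasure N Kᶜ ≤ ENNReal.ofReal δ ∧
        ∀ᵐ y ∂cubeMeasure N, y ∈ K →
          ‖W1p.grad (v n) y - W1p.grad w y‖ ≤ δ * ‖W1p.grad (v n) y‖ := by
  obtain ⟨M₀, hM₀⟩ := exists_bound_on_ball hcont hfin (‖ξ‖ + 1)
  refine ⟨M₀ + (α₁ + α₂) * (1 + α₁), fun δ hδ => ?_⟩
  -- the sets and the cut-off function for `l_ξ`
  have hδ2 : 0 < ENNReal.ofReal (δ / 2) := ENNReal.ofReal_pos.2 (by positivity)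
  obtain ⟨U, hU, hUc, hUY, hUδ⟩ := exists_nested_sets N hδ2
  obtain ⟨V, hV, hUV, hVY, hVc⟩ := exists_open_between_and_isCompact_closure hUc
    (isOpen_unitCube N) hUY
  obtain ⟨ψ, hψ, hψ01, hψ1, -⟩ := exists_testFunction_eq_one isClosed_closure hV hUV hVc hVY
  set Ψ := fun y => ψ y • linFun ξ y with hΨ
  have hΨt : IsTestFunction N Ψ := hψ.smul_linFun ξ
  obtain ⟨B, hB⟩ := (isCompact_bigCube N).exists_bound_of_continuousOn
    (continuous_matGrad (hΨt.1.of_le (by simp))).continuousOn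
  have hΨU : ∀ y ∈ U, matGrad Ψ y = ξ := by
    intro y hy
    rw [← matGrad_linFun ξ y]
    have : Ψ =ᶠ[𝓝 y] linFun ξ := by
      filter_upwards [hU.mem_nhds hy] with z hz
      rw [hΨ]; simp only; rw [hψ1 z (subset_closure hz), one_smul]
    ext ⟨i, j⟩
    simp only [matGrad_apply]
    rw [this.fderiv_eq]
  -- the scaling factors
  set κ : ℝ := min (min (ε / 2 / (‖ξ‖ + 1)) (1 / (|B| + 1))) (min δ 1) with hκ
  -- The bounds in `κ` serve, in order: half of the error `ε` in (D₃), a gradient at most `‖ξ‖ + 1`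
  -- off `U`, closeness `δ` of the gradients on `K`, and nonnegativity of the factors. The loss `κ`
  -- is shared equally between `r` and `l'`.
  have hκ0 : 0 < κ := by positivity
  have hκ1 : κ ≤ 1 := (min_le_right _ _).trans (min_le_right _ _)
  have hκδ : κ ≤ δ := (min_le_right _ _).trans (min_le_left _ _)
  have hκB : κ * |B| ≤ 1 := by
    have : κ ≤ 1 / (|B| + 1) := (min_le_left _ _).trans (min_le_right _ _)
    rw [le_div_iff₀ (by positivity)] at this
    nlinarith
  have hκξ : κ * ‖ξ‖ ≤ ε / 2 := by
    have : κ ≤ ε / 2 / (‖ξ‖ + 1) := (min_le_left _ _).trans (min_le_left _ _)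
    rw [le_div_iff₀ (by positivity)] at this
    nlinarith
  obtain ⟨R, l', hl'0, hl'1, hl'κ, hR⟩ := exists_scaling hfin hD1 hδ (half_pos hκ0)
  set r : ℝ := 1 - κ / 2 with hr
  have hr0 : 0 < r := by linarith
  have hr1 : r < 1 := by linarith
  have hrl1 : r * l' ≤ 1 := mul_le_one₀ hr1.le hl'0.le hl'1.le
  have hrlκ : 1 - r * l' ≤ κ := by nlinarith
  -- The factor `r < 1` exists for this step: (D₃) needs a coefficient bound below one, whereas `φ`
  -- takes the value one.
  obtain ⟨c, hc0, hc⟩ := hD3 ((r * l') • ξ) r hr0.le hr1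
  obtain ⟨M, hM⟩ := exists_bound_on_ball hcont hfin (‖ξ‖ + c + ε)
  obtain ⟨M₁, hM₁⟩ := exists_bound_on_ball hcont hfin R
  -- the cut-off function for `v - l_ξ`
  have hUfin : cubeMeasure N U ≠ ∞ := measure_ne_top _ _
  -- The layer is chosen after `M`, so that `M` times its measure is at most `δ`.
  have hsmall : 0 < min (ENNReal.ofReal (δ / 2)) (ENNReal.ofReal δ / (M + 1)) :=
    lt_min hδ2 (ENNReal.div_pos (ENNReal.ofReal_pos.2 hδ).ne' (by simp))
  obtain ⟨K, hKU, hK, hKδ⟩ := hU.measurableSet.exists_isCompact_sdiff_lt hUfin hsmall.ne'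
  obtain ⟨φ, hφ, hφ01, hφ1, hφ0⟩ := exists_testFunction_eq_one hK.isClosed hU hKU hUc hUY
  obtain ⟨D, hD0, hD⟩ := hφ.exists_norm_fderiv_le
  obtain ⟨k₀, hk₀⟩ := exists_nat_ge M₁
  have hk₀' : (M₁ : ℝ≥0∞) ≤ (k₀ : ℝ≥0∞) := by exact_mod_cast hk₀
  refine ⟨k₀, ?_⟩
  have hu : WeaklyConverges (fun n => v n - linW m N p ξ) 0 := by
    simpa using hv.sub_const (linW m N p ξ)
  -- With `v n - l_ξ` below this bound on `U`, where `ψ = 1`, the tensor term is at most `ε / 2`.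
  have hη : 0 < ε / 2 / (√N * D + 1) := by positivity
  filter_upwards [hψ.eventually_ae_norm_smul_le hp hNp hu hη] with n hn
  refine ⟨competitor ξ (r * l') hψ hφ (v n), competitor_sub_mem hp _ _ hψ hφ _,
    ⟨(U \ K).indicator fun _ => (M : ℝ≥0∞),
      (measurable_const.indicator (hU.measurableSet.diff hK.measurableSet)).aemeasurable, ?_, ?_⟩,
    K, ?_, ?_⟩
  · rw [lintegral_indicator_const (hU.measurableSet.diff hK.measurableSet)]
    calc (M : ℝ≥0∞) * cubeMeasure N (U \ K) ≤ (M + 1) * (ENNReal.ofReal δ / (M + 1)) := by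
          gcongr
          · exact le_self_add
          · exact hKδ.le.trans (min_le_right _ _)
      _ ≤ _ := ENNReal.mul_div_le
  · filter_upwards [grad_competitor ξ (r * l') hψ hφ (v n), hn,
      ae_restrict_mem (isOpen_unitCube N).measurableSet] with y hy hyu hyY
    rw [hy]
    set G := W1p.grad (v n) y with hG
    set a := W1p.val (v n - linW m N p ξ) y with ha
    set f := L G with hf
    set h := min f (k₀ : ℝ≥0∞) with hh
    -- Large gradients use (D₁). For small ones `f ≤ M₁ ≤ k₀`, so the truncation is inactive and
    -- (D₂) suffices.
    have hH : L (l' • G) ≤ α₁ * (1 + h) + ENNReal.ofReal δ * f := by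
      rcases le_or_gt R ‖G‖ with hGR | hGR
      · exact (hR G hGR).trans le_add_self
      · have : h = f := min_eq_left ((hM₁ G hGR.le).trans hk₀')
        rw [this]
        exact (hD2 G l' hl'0 hl'1).trans le_self_add
    have hfinal := fun x => le_affine_of_le_or_le (x := x) (M₀ := M₀) (α₂ := α₂) hH
    by_cases hyU : y ∈ U
    · rw [hΨU y hyU]
      by_cases hyK : y ∈ K
      · have hyd : y ∉ U \ K := fun h => h.2 hyK
        rw [indicator_of_notMem hyd, add_zero, hφ1 y hyK,
          fderiv_eq_zero_of_eq_one hφ01 (hφ1 y hyK), tensor_zero]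
        refine hfinal _ (Or.inr ?_)
        have : ξ - (1 - r * l') • ξ + (r * l') • ((1 : ℝ) • (G - ξ) + 0) = r • (l' • G) := by
          module
        rw [this]
        refine (hD2 _ r hr0 hr1).trans ?_
        gcongr
        exact le_self_add
      · rw [indicator_of_mem (show y ∈ U \ K from ⟨hyU, hyK⟩), ← add_assoc, smul_add]
        have he : ‖(r * l') • tensor a (fderiv ℝ φ y)‖ + (1 - r) * ‖ξ‖ ≤ ε := by
          have h1 : ‖a‖ ≤ ε / 2 / (√N * D + 1) := by
            have := hyu
            rwa [hψ1 y (subset_closure hyU), one_smul] at this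
          have h2 : ‖(r * l') • tensor a (fderiv ℝ φ y)‖ ≤ ε / 2 := by
            rw [norm_smul, Real.norm_of_nonneg (by positivity)]
            calc r * l' * ‖tensor a (fderiv ℝ φ y)‖ ≤ ‖tensor a (fderiv ℝ φ y)‖ :=
                  mul_le_of_le_one_left (norm_nonneg _) hrl1
              _ ≤ √N * ‖a‖ * ‖fderiv ℝ φ y‖ := norm_tensor_le _ _
              _ ≤ √N * (ε / 2 / (√N * D + 1)) * D := by gcongr; exact hD y
              _ = (ε / 2 / (√N * D + 1)) * (√N * D) := by ring
              _ ≤ (ε / 2 / (√N * D + 1)) * (√N * D + 1) := by gcongr; linarith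
              _ = ε / 2 := div_mul_cancel₀ _ (by positivity)
          have h3 : (1 - r) * ‖ξ‖ ≤ ε / 2 := by
            refine le_trans ?_ hκξ
            gcongr
            linarith
          linarith
        refine (le_of_growth hr0.le hr1.le hl'0.le hl'1.le (hφ01 y).1 (hφ01 y).2
          (fun t ζ e h0 h1 h2 h3 => hc t ζ e h0 h1 h2 h3) hM he).trans ?_
        gcongr
        refine hfinal _ (Or.inr ?_)
        gcongr
        exact le_add_self
    · have hyd : y ∉ U \ K := fun h => hyU h.1
      rw [indicator_of_notMem hyd, add_zero, hφ0 y hyU,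
        fderiv_eq_zero_of_eq_zero hφ01 (hφ0 y hyU), tensor_zero, zero_smul, add_zero, smul_zero,
        add_zero]
      refine hfinal _ (Or.inl (hM₀ _ ?_))
      refine (norm_sub_le _ _).trans ?_
      gcongr
      rw [norm_smul, Real.norm_of_nonneg (by linarith)]
      calc (1 - r * l') * ‖matGrad Ψ y‖ ≤ κ * |B| := by
            gcongr
            exact (hB y (unitCube_subset_Icc N hyY)).trans (le_abs_self B)
        _ ≤ 1 := hκB
  · calc cubeMeasure N Kᶜ ≤ cubeMeasure N (Uᶜ ∪ U \ K) := by
          refine measure_mono fun y hy => ?_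
          by_cases h : y ∈ U
          · exact Or.inr ⟨h, hy⟩
          · exact Or.inl h
      _ ≤ cubeMeasure N Uᶜ + cubeMeasure N (U \ K) := measure_union_le _ _
      _ ≤ ENNReal.ofReal (δ / 2) + ENNReal.ofReal (δ / 2) :=
          add_le_add hUδ (hKδ.le.trans (min_le_left _ _))
      _ = ENNReal.ofReal δ := by
          rw [← ENNReal.ofReal_add (by positivity) (by positivity), add_halves]
  · filter_upwards [grad_competitor ξ (r * l') hψ hφ (v n)] with y hy hyK
    rw [hy, hΨU y (hKU hyK), hφ1 y hyK, fderiv_eq_zero_of_eq_one hφ01 (hφ1 y hyK), tensor_zero]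
    have : W1p.grad (v n) y - (ξ - (1 - r * l') • ξ +
        (r * l') • ((1 : ℝ) • (W1p.grad (v n) y - ξ) + 0)) =
        (1 - r * l') • W1p.grad (v n) y := by module
    rw [this, norm_smul, Real.norm_of_nonneg (by linarith)]
    gcongr
    linarith

end Competitors

/-! ### Convergence in measure and conclusion -/

theorem tendsto_ofReal_one_div_add_one :
    Tendsto (fun j : ℕ => ENNReal.ofReal (1 / ((j : ℝ) + 1))) atTop (𝓝 0) := by
  simpa using ENNReal.tendsto_ofReal tendsto_one_div_add_atTop_nhds_zero_nat

/-- Off `K j` the measure is small; on `K j` Markov's inequality is applied to `δ j * ‖G j‖`, using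
the uniform `L^1` bound. -/
theorem tendstoInMeasure_norm_sub_of_le {α F : Type*} [MeasurableSpace α] {μ : Measure α}
    [NormedAddCommGroup F] {G H : ℕ → α → F} {δ : ℕ → ℝ} (hδ : ∀ j, 0 < δ j)
    (hδ0 : Tendsto (fun j => ENNReal.ofReal (δ j)) atTop (𝓝 0))
    (hG : ∀ j, AEStronglyMeasurable (G j) μ)
    {C : ℝ≥0∞} (hC : C ≠ ∞) (hGC : ∀ j, ∫⁻ y, ‖G j y‖ₑ ∂μ ≤ C) {K : ℕ → Set α}
    (hK : ∀ j, μ (K j)ᶜ ≤ ENNReal.ofReal (δ j))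
    (hGH : ∀ j, ∀ᵐ y ∂μ, y ∈ K j → ‖G j y - H j y‖ ≤ δ j * ‖G j y‖) :
    TendstoInMeasure μ (fun j y => ‖G j y - H j y‖) atTop (fun _ => (0 : ℝ)) := by
  rw [tendstoInMeasure_iff_norm]
  intro η hη
  have hη' : ENNReal.ofReal η ≠ 0 := (ENNReal.ofReal_pos.2 hη).ne'
  have hlim : Tendsto (fun j => ENNReal.ofReal (δ j) + ENNReal.ofReal (δ j) * C /
      ENNReal.ofReal η) atTop (𝓝 0) := by
    have h1 := ENNReal.Tendsto.mul_const hδ0 (Or.inr hC)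
    have h2 := ENNReal.Tendsto.div_const h1 (Or.inr hη')
    simpa using hδ0.add h2
  refine tendsto_of_tendsto_of_tendsto_of_le_of_le tendsto_const_nhds hlim (fun _ => zero_le)
    fun j => ?_
  have hsub : {y | η ≤ ‖‖G j y - H j y‖ - 0‖} ≤ᵐ[μ]
      ((K j)ᶜ ∪ {y | ENNReal.ofReal η ≤ ENNReal.ofReal (δ j) * ‖G j y‖ₑ} : Set α) := by
    filter_upwards [hGH j] with y hy hyη
    by_cases hyK : y ∈ K j
    · refine Or.inr ?_
      have h1 : η ≤ ‖‖G j y - H j y‖ - 0‖ := hyη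
      rw [sub_zero, norm_norm] at h1
      change ENNReal.ofReal η ≤ _
      rw [← ofReal_norm, ← ENNReal.ofReal_mul (hδ j).le]
      exact ENNReal.ofReal_le_ofReal (h1.trans (hy hyK))
    · exact Or.inl hyK
  refine (measure_mono_ae hsub).trans ((measure_union_le _ _).trans (add_le_add (hK j) ?_))
  refine (meas_ge_le_lintegral_div ((hG j).enorm.const_mul _) hη' ENNReal.ofReal_ne_top).trans ?_
  rw [lintegral_const_mul' _ _ ENNReal.ofReal_ne_top]
  gcongr
  exact hGC j

variable {m N : ℕ} {p : ℝ≥0∞} [hp1 : Fact (1 ≤ p)]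

theorem WeaklyConverges.exists_lintegral_grad_le {v : ℕ → W1p m N p} {u : W1p m N p}
    (hv : WeaklyConverges v u) :
    ∃ C : ℝ≥0∞, C ≠ ∞ ∧ ∀ n, ∫⁻ y, ‖W1p.grad (v n) y‖ₑ ∂cubeMeasure N ≤ C := by
  obtain ⟨C, hC⟩ := hv.exists_norm_le
  have hexp : 0 ≤ 1 / (1 : ℝ≥0∞).toReal - 1 / p.toReal := by
    simp only [ENNReal.toReal_one, div_one, sub_nonneg]
    rcases eq_or_ne p ∞ with rfl | hp
    · simp
    have hq : 1 ≤ p.toReal := by simpa using ENNReal.toReal_mono hp hp1.out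
    rw [div_le_one (by linarith)]
    exact hq
  refine ⟨ENNReal.ofReal C * cubeMeasure N univ ^ (1 / (1 : ℝ≥0∞).toReal - 1 / p.toReal),
    ENNReal.mul_ne_top ENNReal.ofReal_ne_top
      (ENNReal.rpow_ne_top_of_nonneg hexp (measure_ne_top _ _)), fun n => ?_⟩
  rw [← eLpNorm_one_eq_lintegral_enorm]
  refine (eLpNorm_le_eLpNorm_mul_rpow_measure_univ hp1.out (W1p.memLp_grad (v n)).1).trans ?_
  gcongr
  rw [← ENNReal.ofReal_toReal (W1p.memLp_grad (v n)).eLpNorm_ne_top]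
  exact ENNReal.ofReal_le_ofReal ((norm_snd_le (v n).1).trans (hC n))

end LocPrinciple

theorem theorem1p3 (m N : ℕ) (hm : 1 ≤ m) (hN : 1 ≤ N)
    (L : LocPrinciple.Mat m N → ℝ≥0∞)
    (hcont : Continuous L) (hfin : ∀ ξ, L ξ < ∞)
    (hD1 : ∃ lam : ℝ → ℝ, (∀ R, 0 < R → 0 < lam R ∧ lam R < 1) ∧
      Tendsto lam atTop (𝓝 1) ∧
      Tendsto (fun R : ℝ => ⨆ (ξ : LocPrinciple.Mat m N) (_ : R ≤ ‖ξ‖), L (lam R • ξ) / L ξ)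
        atTop (𝓝 0))
    (hD2 : ∃ α₁ : ℝ≥0, 0 < α₁ ∧ ∀ (ξ : LocPrinciple.Mat m N) (t : ℝ), 0 < t → t < 1 →
      L (t • ξ) ≤ α₁ * (1 + L ξ))
    (hD3 : ∃ (α₂ : ℝ≥0) (ε : ℝ), 0 < α₂ ∧ 0 < ε ∧
      ∀ (ξ : LocPrinciple.Mat m N) (t : ℝ), 0 ≤ t → t < 1 →
        ∃ c : ℝ, 0 < c ∧ ∀ (s : ℝ) (ζ e : LocPrinciple.Mat m N),
          0 ≤ s → s ≤ t → c ≤ ‖ζ‖ → ‖e‖ ≤ ε →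
            L (ξ + s • ζ + e) ≤ α₂ * (1 + L (ξ + ζ)))
    (p : ℝ≥0∞) [Fact (1 ≤ p)] (hNp : (N : ℝ≥0∞) < p) (hp : p < ∞) :
    LocPrinciple.LocalizationPrinciple m N L p := by
  obtain ⟨α₁, -, hα₁⟩ := hD2
  obtain ⟨α₂, ε, -, hε, hα₂⟩ := hD3
  intro ξ v hv hsup
  set C := ⨆ n, ∫⁻ y, L (LocPrinciple.W1p.grad (v n) y) ∂LocPrinciple.cubeMeasure N with hC
  have hfC : ∀ n, ∫⁻ y, L (LocPrinciple.W1p.grad (v n) y) ∂LocPrinciple.cubeMeasure N ≤ C :=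
    fun n => le_iSup (fun n => ∫⁻ y, L (LocPrinciple.W1p.grad (v n) y) ∂LocPrinciple.cubeMeasure N) n
  have hfm : ∀ n, AEMeasurable (fun y => L (LocPrinciple.W1p.grad (v n) y))
      (LocPrinciple.cubeMeasure N) := fun n =>
    hcont.measurable.comp_aemeasurable (LocPrinciple.W1p.memLp_grad (v n)).1.aemeasurable
  obtain ⟨τ, hτ, hE⟩ := LocPrinciple.exists_strictMono_equiIntegrable_min hsup.ne hfm hfC
  obtain ⟨A, hA⟩ := LocPrinciple.exists_competitor hcont hfin hD1 hα₁ hε hα₂ hp.ne hNp hv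
  have hδ : ∀ j : ℕ, 0 < 1 / ((j : ℝ) + 1) := fun j => by positivity
  choose k₀ hk₀ using fun j : ℕ => hA _ (hδ j)
  -- Besides providing a competitor, `ρ j` must reach `k₀ j`: then truncation at `k₀ j` lies below
  -- truncation at `ρ j`, which is equi-integrable along `τ ∘ ρ`.
  obtain ⟨ρ, hρ, hρ'⟩ := extraction_forall_of_eventually fun j =>
    (eventually_ge_atTop (k₀ j)).and (hτ.tendsto_atTop.eventually (hk₀ j))
  choose hρk w hw hg K hK hwK using hρ'
  choose g hgm hgδ hgL using hg
  obtain ⟨CG, hCG, hGC⟩ := hv.exists_lintegral_grad_le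
  refine ⟨fun j => τ (ρ j), w, hτ.comp hρ, hw, ?_, ?_⟩
  · exact LocPrinciple.tendstoInMeasure_norm_sub_of_le hδ
      LocPrinciple.tendsto_ofReal_one_div_add_one
      (fun j => (LocPrinciple.W1p.memLp_grad (v (τ (ρ j)))).1) hCG (fun j => hGC _) hK hwK
  -- The remainder vanishes in `L^1` because the energies are bounded by `C` and `A` does not depend
  -- on `j`.
  · have hbound : ∀ j : ℕ, ∫⁻ y, (A * ENNReal.ofReal (1 / ((j : ℝ) + 1)) *
        L (LocPrinciple.W1p.grad (v (τ (ρ j))) y) + g j y) ∂LocPrinciple.cubeMeasure N ≤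
        A * ENNReal.ofReal (1 / ((j : ℝ) + 1)) * C + ENNReal.ofReal (1 / ((j : ℝ) + 1)) := by
      intro j
      rw [lintegral_add_right' _ (hgm j), lintegral_const_mul' _ _
        (ENNReal.mul_ne_top ENNReal.coe_ne_top ENNReal.ofReal_ne_top)]
      gcongr
      · exact hfC _
      · exact hgδ j
    refine LocPrinciple.EquiIntegrable.of_le_affine_add (ENNReal.coe_ne_top (r := A)) (hE.comp ρ)
      (fun j => (hfm _).min aemeasurable_const)
      (g := fun (j : ℕ) y => A * ENNReal.ofReal (1 / ((j : ℝ) + 1)) *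
        L (LocPrinciple.W1p.grad (v (τ (ρ j))) y) + g j y) ?_ (fun j => ?_) (fun j => ?_)
    · refine tendsto_of_tendsto_of_tendsto_of_le_of_le tendsto_const_nhds ?_ (fun _ => zero_le)
        hbound
      have h0 := LocPrinciple.tendsto_ofReal_one_div_add_one
      have h1 := ENNReal.Tendsto.const_mul h0 (Or.inr (ENNReal.coe_ne_top (r := A)))
      have h2 := ENNReal.Tendsto.mul_const h1 (Or.inr hsup.ne)
      simpa using h2.add h0
    · refine ((hbound j).trans_lt (ENNReal.add_lt_top.2 ⟨?_, ENNReal.ofReal_lt_top⟩)).ne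
      exact ENNReal.mul_lt_top (ENNReal.mul_lt_top ENNReal.coe_lt_top ENNReal.ofReal_lt_top) hsup
    · filter_upwards [hgL j] with y hy
      refine hy.trans ?_
      gcongr
      exact hρk j
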